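/- Let $\mathbb{D}=\{z\in\mathbb{C}:|z|<1\}$ and let $\mathcal{H}$ be the complex topological vector space of analytic functions on $\mathbb{D}$ with the topology of uniform convergence on compact subsets of $\mathbb{D}$. Let $\mathcal{A}$ be the set of $f\in\mathcal{H}$ with $f(0)=0$ and $f'(0)=1$, and let $\mathscr{G}$ be the set of $f\in\mathcal{A}$ such that $f'(z)\neq 0$ and $$\mathrm{Re}\left(1+\frac{zf''(z)}{f'(z)}\right)>-\frac12\qquad\text{for all } z\in\mathbb{D}.$$ For $\mathcal{F}\subseteq\mathcal{H}$, let $\mathrm{supp}\,\mathcal{F}$ be the set of support points of $\mathcal{F}$, that is, of those $f\in\mathcal{F}$ for which there is a continuous linear functional $J:\mathcal{H}\to\mathbb{C}$ such that $\mathrm{Re}\,J$ is non-constant on $\mathcal{F}$ and $\mathrm{Re}\,J(f)=\max\{\mathrm{Re}\,J(g):g\in\mathcal{F}\}$. Let $\overline{co}\,\mathcal{F}$ be the closed convex hull of $\mathcal{F}$ in $\mathcal{H}$ (the intersection of all closed convex sets containing $\mathcal{F}$), and let $E\,\overline{co}\,\mathcal{F}$ be the set of its extreme points. Then $$\mathrm{supp}\,\mathscr{G}=E\,\overline{co}\,\mathscr{G}=\left\{\frac{z-\frac{x}{2}z^2}{(1-xz)^2}: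 x\in\mathbb{C},\ |x|=1\right\}.$$ -/

import Mathlib

noncomputable section

/-- The open unit disk `𝔻`. -/
abbrev unitDisk : Set ℂ := Metric.ball 0 1

open Classical in
/-- A function on the disk, read as a function on `ℂ` that vanishes off the disk; it is only ever
evaluated or differentiated at points of the (open) disk. -/
def diskExt (f : C(unitDisk, ℂ)) : ℂ → ℂ :=
  fun z => if h : z ∈ unitDisk then f ⟨z, h⟩ else 0

theorem diskExt_of_mem (f : C(unitDisk, ℂ)) {z : ℂ} (h : z ∈ unitDisk) :
    diskExt f z = f ⟨z, h⟩ := dif_pos h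

/-- The space `𝓗` of analytic functions on the unit disk, as a subspace of `C(𝔻, ℂ)`. Mathlib's
topology on `C(𝔻, ℂ)` is the compact-open one, i.e. that of uniform convergence on compact
subsets of `𝔻`, and `𝓗` carries the subspace topology. -/
def AnalyticDisk : Submodule ℂ C(unitDisk, ℂ) where
  carrier := {f | AnalyticOnNhd ℂ (diskExt f) unitDisk}
  zero_mem' := by
    have h : diskExt 0 = fun _ => (0 : ℂ) := by
      funext z; simp [diskExt]
    rw [Set.mem_ofPred_eq, h]
    exact analyticOnNhd_const
  add_mem' := by
    intro f g hf hg
    have h : diskExt (f + g) = diskExt f + diskExt g := by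
      funext z
      by_cases hz : z ∈ unitDisk <;> simp only [diskExt, hz, dite_true, dite_false, Pi.add_apply,
        ContinuousMap.add_apply, add_zero]
    rw [Set.mem_ofPred_eq, h]
    exact AnalyticOnNhd.add hf hg
  smul_mem' := by
    intro c f hf
    have h : diskExt (c • f) = fun z => c * diskExt f z := by
      funext z
      by_cases hz : z ∈ unitDisk <;> simp only [diskExt, hz, dite_true, dite_false,
        ContinuousMap.smul_apply, smul_eq_mul, mul_zero]
    rw [Set.mem_ofPred_eq, h]
    exact analyticOnNhd_const.mul hf

/-- The class `𝓐` of analytic functions on the disk with `f 0 = 0` and `f' 0 = 1`. -/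
def classA : Set AnalyticDisk :=
  {f | diskExt f 0 = 0 ∧ deriv (diskExt f) 0 = 1}

/-- The class `𝓖`: functions `f ∈ 𝓐` with `Re (1 + z f''(z) / f'(z)) > -1/2` on the disk. The
quotient has to be meaningful, so `f'` has no zero in the disk. -/
def classG : Set AnalyticDisk :=
  {f | f ∈ classA ∧ ∀ z ∈ unitDisk, deriv (diskExt f) z ≠ 0 ∧
    -(1 / 2 : ℝ) < (1 + z * deriv (deriv (diskExt f)) z / deriv (diskExt f) z).re}

/-- The support points of a family `F ⊆ 𝓗`: the points of `F` at which the real part of some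
continuous linear functional, non-constant on `F`, attains its maximum over `F`. -/
def supportPoints (F : Set AnalyticDisk) : Set AnalyticDisk :=
  {f | f ∈ F ∧ ∃ J : AnalyticDisk →L[ℂ] ℂ,
    (∃ g ∈ F, ∃ h ∈ F, (J g).re ≠ (J h).re) ∧ IsMaxOn (fun g => (J g).re) F f}

theorem one_sub_mul_ne_zero_of_mem_unitDisk {x z : ℂ} (hx : ‖x‖ = 1) (hz : z ∈ unitDisk) :
    1 - x * z ≠ 0 := by
  intro h
  have h1 : ‖x * z‖ = 1 := by rw [← sub_eq_zero.mp h, norm_one]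
  rw [norm_mul, hx, one_mul] at h1
  rw [mem_ball_zero_iff] at hz
  linarith

/-- The function `z ↦ (z - (x/2) z²) / (1 - x z)²` on the disk, for `|x| = 1`. -/
def extremalFun (x : ℂ) (hx : ‖x‖ = 1) : AnalyticDisk :=
  ⟨{ toFun := fun z => ((z : ℂ) - x / 2 * (z : ℂ) ^ 2) / (1 - x * (z : ℂ)) ^ 2
     continuous_toFun := by
       refine Continuous.div (by fun_prop) (by fun_prop) fun z => ?_
       exact pow_ne_zero 2 (one_sub_mul_ne_zero_of_mem_unitDisk hx z.2) }, by
    have h : AnalyticOnNhd ℂ (fun z : ℂ => (z - x / 2 * z ^ 2) / (1 - x * z) ^ 2) unitDisk := by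
      refine AnalyticOnNhd.div (fun z _ => by fun_prop) (fun z _ => by fun_prop) fun z hz => ?_
      exact pow_ne_zero 2 (one_sub_mul_ne_zero_of_mem_unitDisk hx hz)
    refine h.congr Metric.isOpen_ball fun z hz => ?_
    rw [diskExt_of_mem _ hz]
    rfl⟩

end

/-! For `f ∈ 𝓖` put `h = f'` and `s = 1 + z h' / (3 h)`. The defining inequality says exactly that
`Re s > 1/2`, and `s 0 = 1`, so Herglotz gives a probability measure `μ` on the circle with `s = ∫
(1 - x z)⁻¹ dμ`. The heart of the proof is that then `h = ∫ (1 - x z)⁻³ dν` for a probability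
measure `ν`, i.e. `f` is an average of the functions `extremalFun x`.

To find `ν`, compare coefficients in `h + z h' / 3 = h s`. With `h = ∑ C(n+2, 2) cₙ zⁿ` this becomes
`C(n+3, 3) cₙ = ∑ C(k+2, 2) cₖ μ_{n-k}`, which formally reads `∫ (1 - x z)⁻⁴ dν = ∫ (1 - x z)⁻³ dν *
∫ (1 - x z)⁻¹ dμ`. For any `ν`, the right-hand side is `∫ (1 - x z)⁻⁴ dξ` with a probability measure
`ξ` (`exists_circleMoment_mix`). The map `ν ↦ ξ` contracts every finite block of moments, so its
iterates converge to `c`; moment sequences form a closed set, hence `c` is one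
(`exists_circleMoment_eq_of_recursion`).

A continuous functional `J` acts on represented functions as `∫ F dν`, with `F x = J (extremalFun
x)` analytic across the circle (`exists_apply_eq_integral`). By Hahn-Banach the closed convex hull
of `𝓖` consists of all represented functions, and its extreme points correspond to point masses.

If `f ∈ 𝓖` maximizes `Re J`, then `ν` lives where `Re F` is maximal. By real-analyticity this is the
whole circle, which makes `Re J` constant on `𝓖`, or a finite set, so that `ν` has an atom `a`.
Radial limits at `a` in the product identity give `ν{a} = ν{a} μ{a}`; so `μ` is the point mass at
`a`, and the recursion forces `cₙ = aⁿ` (`circleMoment_eq_pow_of_atom`). -/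

open MeasureTheory Filter Topology Complex

/-! ### Moment sequences of probability measures on the unit circle -/

/-- The unit circle as a subtype of `ℂ`. -/
abbrev unitSphere : Type := Metric.sphere (0 : ℂ) 1

theorem norm_coe_unitSphere (x : unitSphere) : ‖(x : ℂ)‖ = 1 := by
  simp

/-- The moments `∫ xⁿ dν` of a probability measure on the unit circle. -/
noncomputable def circleMoment (ν : ProbabilityMeasure unitSphere) (n : ℕ) : ℂ :=
  ∫ x : unitSphere, (x : ℂ) ^ n ∂(ν : Measure unitSphere)

theorem integrable_of_norm_le {Ω E : Type*} [MeasurableSpace Ω] [NormedAddCommGroup E]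
    {P : Measure Ω} [IsFiniteMeasure P] {f : Ω → E} {B : ℝ} (hf : AEStronglyMeasurable f P)
    (hB : ∀ ω, ‖f ω‖ ≤ B) : Integrable f P :=
  Integrable.of_bound hf B (ae_of_all _ hB)

theorem integrable_pow_unitSphere (ν : Measure unitSphere) [IsFiniteMeasure ν] (n : ℕ) :
    Integrable (fun x : unitSphere => (x : ℂ) ^ n) ν := by
  refine integrable_of_norm_le (B := 1) (by fun_prop) fun x => ?_
  simp

theorem circleMoment_zero (ν : ProbabilityMeasure unitSphere) : circleMoment ν 0 = 1 := by
  simp [circleMoment]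

theorem norm_circleMoment_le (ν : ProbabilityMeasure unitSphere) (n : ℕ) :
    ‖circleMoment ν n‖ ≤ 1 := by
  refine (norm_integral_le_of_norm_le_const (C := 1) (ae_of_all _ fun x => ?_)).trans ?_
  · simp
  · simp

theorem continuous_circleMoment : Continuous circleMoment := by
  refine continuous_pi fun n => ?_
  rw [continuous_iff_continuousAt]
  intro ν
  have h := (ProbabilityMeasure.tendsto_iff_forall_integral_rclike_tendsto ℂ
    (F := 𝓝 ν) (μs := id) (μ := ν)).1 tendsto_id
    (BoundedContinuousFunction.mkOfCompact ⟨fun x : unitSphere => (x : ℂ) ^ n, by fun_prop⟩)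
  exact h

/-- Probability measures on the compact circle form a weakly compact space. This is what allows
passing to limits of moment sequences term by term, both in Herglotz' theorem and in the fixed-point
iteration. -/
theorem isClosed_range_circleMoment : IsClosed (Set.range circleMoment) :=
  (isCompact_range continuous_circleMoment).isClosed

theorem hasSum_integral_of_norm_le {Ω : Type*} [MeasurableSpace Ω] {P : Measure Ω}
    [IsFiniteMeasure P] {F : ℕ → Ω → ℂ} {G : Ω → ℂ} {B : ℕ → ℝ}
    (hF : ∀ n, AEStronglyMeasurable (F n) P) (hB : Summable B) (hFB : ∀ n ω, ‖F n ω‖ ≤ B n)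
    (hG : ∀ ω, HasSum (fun n => F n ω) (G ω)) :
    HasSum (fun n => ∫ ω, F n ω ∂P) (∫ ω, G ω ∂P) :=
  hasSum_integral_of_dominated_convergence (fun n _ => B n) hF
    (fun n => ae_of_all _ (hFB n)) (ae_of_all _ fun _ => hB) (integrable_const _)
    (ae_of_all _ hG)

theorem exists_circleMoment_eq_integral {Ω : Type*} [MeasurableSpace Ω] {P : Measure Ω}
    {g : Ω → ℝ} (hgm : Measurable g) (hg : Integrable g P) (hg0 : ∀ ω, 0 ≤ g ω)
    (hg1 : ∫ ω, g ω ∂P = 1) {φ : Ω → unitSphere} (hφ : Measurable φ) :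
    ∃ ν, ∀ n, circleMoment ν n = ∫ ω, (g ω : ℂ) * (φ ω : ℂ) ^ n ∂P := by
  set Q : Measure Ω := P.withDensity (fun ω => ENNReal.ofReal (g ω)) with hQ
  have hQp : IsProbabilityMeasure Q := by
    constructor
    rw [hQ, withDensity_apply _ MeasurableSet.univ, Measure.restrict_univ,
      ← ofReal_integral_eq_lintegral_ofReal hg (ae_of_all _ hg0), hg1, ENNReal.ofReal_one]
  have hp : IsProbabilityMeasure (Q.map φ) := Measure.isProbabilityMeasure_map hφ.aemeasurable
  refine ⟨⟨Q.map φ, hp⟩, fun n => ?_⟩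
  unfold circleMoment
  rw [ProbabilityMeasure.coe_mk, integral_map hφ.aemeasurable (by fun_prop), hQ,
    integral_withDensity_eq_integral_toReal_smul hgm.ennreal_ofReal (by simp)]
  refine integral_congr_ae (ae_of_all _ fun ω => ?_)
  simp [ENNReal.toReal_ofReal (hg0 ω)]

/-! ### Herglotz' theorem for moment sequences -/

theorem integral_exp_int_mul_I (m : ℤ) :
    ∫ θ in Set.Ioc 0 (2 * Real.pi), exp (m * θ * I) = if m = 0 then (2 * Real.pi : ℂ) else 0 := by
  rw [← intervalIntegral.integral_of_le Real.two_pi_pos.le]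
  split_ifs with h
  · simp [h]
  · have hc : (m : ℂ) * I ≠ 0 := mul_ne_zero (by exact_mod_cast h) I_ne_zero
    have := integral_exp_mul_complex (a := 0) (b := 2 * Real.pi) hc
    simp only [mul_right_comm _ I] at this
    rw [this]
    have h2 : exp ((m : ℂ) * ((2 * Real.pi : ℝ) : ℂ) * I) = 1 := by
      rw [Complex.exp_eq_one_iff]
      exact ⟨m, by push_cast; ring⟩
    rw [h2]; simp

theorem summable_norm_mul_pow {c : ℕ → ℂ} {q : ℂ → ℂ}
    (hq : ∀ z, ‖z‖ < 1 → HasSum (fun n => c n * z ^ n) (q z)) {ρ : ℝ} (h0 : 0 ≤ ρ) (h1 : ρ < 1) :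
    Summable fun n => ‖c n‖ * ρ ^ n := by
  have := (hq ρ (by simpa [abs_of_nonneg h0] using h1)).summable.norm
  simpa [abs_of_nonneg h0] using this

/-- **Herglotz' theorem**, for power series `q` with `q 0 = 1` and `Re q ≥ 1/2` in the disk. -/
theorem exists_circleMoment_eq_of_half_le_re {c : ℕ → ℂ} {q : ℂ → ℂ} (hc : c 0 = 1)
    (hq : ∀ z, ‖z‖ < 1 → HasSum (fun n => c n * z ^ n) (q z))
    (hre : ∀ z, ‖z‖ < 1 → 1 / 2 ≤ (q z).re) : ∃ ν, circleMoment ν = c := by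
  -- The dilation `q (ρ z)` is continuous up to the circle, so its measure has an explicit density;
  -- `ρ → 1` is handled by closedness of the moment sequences.
  have key : ∀ ρ : ℝ, 0 ≤ ρ → ρ < 1 → (fun n => c n * ρ ^ n) ∈ Set.range circleMoment := by
    intro ρ h0 h1
    set P : Measure ℝ := volume.restrict (Set.Ioc 0 (2 * Real.pi)) with hP
    have hPf : IsFiniteMeasure P := by rw [hP]; infer_instance
    have hs := summable_norm_mul_pow hq h0 h1
    have hn : ∀ θ : ℝ, ‖(ρ : ℂ) * exp (-θ * I)‖ < 1 := by
      intro θ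
      have : ‖exp (-θ * I)‖ = 1 := by exact_mod_cast norm_exp_ofReal_mul_I (-θ)
      rw [norm_mul, this]; simpa [abs_of_nonneg h0] using h1
    -- The sign of the angle is chosen so that integrating against `exp (θ * I) ^ n` picks out the
    -- coefficient of index `n`.
    set u : ℝ → ℂ := fun θ => q (ρ * exp (-θ * I)) with hu
    have huS : ∀ θ : ℝ, HasSum (fun k => c k * (ρ * exp (-θ * I)) ^ k) (u θ) := fun θ => hq _ (hn θ)
    have hterm : ∀ k (θ : ℝ), ‖c k * (ρ * exp (-θ * I)) ^ k‖ ≤ ‖c k‖ * ρ ^ k := by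
      intro k θ
      have : ‖exp (-θ * I)‖ = 1 := by exact_mod_cast norm_exp_ofReal_mul_I (-θ)
      rw [norm_mul, norm_pow, norm_mul, this]; simp [abs_of_nonneg h0]
    have hucont : Continuous u := by
      have : u = fun θ : ℝ => ∑' k, c k * (ρ * exp (-θ * I)) ^ k := by
        funext θ; exact (huS θ).tsum_eq.symm
      rw [this]
      exact continuous_tsum (fun k => by fun_prop) hs hterm
    have hE : ∀ (n : ℕ) (θ : ℝ), exp (θ * I) ^ n = exp ((n : ℤ) * θ * I) := by
      intro n θ; rw [← Complex.exp_nat_mul]; congr 1; push_cast; ring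
    have hexp1 : ∀ (n : ℕ) (θ : ℝ), ‖exp (θ * I) ^ n‖ = 1 := fun n θ => by
      rw [norm_pow, norm_exp_ofReal_mul_I, one_pow]
    have hconj : ∀ θ : ℝ, (starRingEnd ℂ) (exp (-θ * I)) = exp (θ * I) := by
      intro θ; rw [← Complex.exp_conj]; simp
    have e0 : ∀ n : ℕ, ∫ θ : ℝ, exp (θ * I) ^ n ∂P = if n = 0 then (2 * Real.pi : ℂ) else 0 := by
      intro n
      simp_rw [hE]
      rw [integral_exp_int_mul_I]; simp
    have e1 : ∀ n : ℕ, ∫ θ, u θ * exp (θ * I) ^ n ∂P = 2 * Real.pi * (c n * ρ ^ n) := by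
      intro n
      have h := hasSum_integral_of_norm_le (P := P)
        (F := fun k θ => c k * (ρ * exp (-(θ : ℝ) * I)) ^ k * exp (θ * I) ^ n)
        (fun k => by fun_prop) hs
        (fun k θ => by rw [norm_mul, hexp1, mul_one]; exact hterm k θ)
        (fun θ => (huS θ).mul_right _)
      have h2 : ∀ k, ∫ θ, c k * (ρ * exp (-(θ : ℝ) * I)) ^ k * exp (θ * I) ^ n ∂P
          = if k = n then 2 * Real.pi * (c n * ρ ^ n) else 0 := by
        intro k
        have : ∀ θ : ℝ, c k * (ρ * exp (-(θ : ℝ) * I)) ^ k * exp (θ * I) ^ n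
            = (c k * ρ ^ k) * exp (((n : ℤ) - (k : ℤ) : ℤ) * θ * I) := by
          intro θ
          rw [mul_pow, ← Complex.exp_nat_mul, ← Complex.exp_nat_mul, ← mul_assoc, mul_assoc,
            ← Complex.exp_add]
          congr 2; push_cast; ring
        simp_rw [this]
        rw [integral_const_mul, integral_exp_int_mul_I]
        rcases eq_or_ne k n with rfl | hkn
        · simp; ring
        · have : (n : ℤ) - k ≠ 0 := by omega
          simp [this, hkn]
      simp_rw [h2] at h
      exact h.unique (hasSum_ite_eq n _)
    have e2 : ∀ n : ℕ, ∫ θ, (starRingEnd ℂ) (u θ) * exp (θ * I) ^ n ∂P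
        = if n = 0 then (2 * Real.pi : ℂ) else 0 := by
      intro n
      have h := hasSum_integral_of_norm_le (P := P)
        (F := fun k θ => (starRingEnd ℂ) (c k * (ρ * exp (-(θ : ℝ) * I)) ^ k) * exp (θ * I) ^ n)
        (fun k => by fun_prop) hs
        (fun k θ => by rw [norm_mul, hexp1, mul_one, RCLike.norm_conj]; exact hterm k θ)
        (fun θ => ((huS θ).map (starRingEnd ℂ) continuous_conj).mul_right _)
      have h2 : ∀ k, ∫ θ, (starRingEnd ℂ) (c k * (ρ * exp (-(θ : ℝ) * I)) ^ k) *
          exp (θ * I) ^ n ∂P = if k = 0 then (if n = 0 then (2 * Real.pi : ℂ) else 0) else 0 := by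
        intro k
        have : ∀ θ : ℝ, (starRingEnd ℂ) (c k * (ρ * exp (-(θ : ℝ) * I)) ^ k) * exp (θ * I) ^ n
            = ((starRingEnd ℂ) (c k) * ρ ^ k) * exp (((n : ℤ) + (k : ℤ) : ℤ) * θ * I) := by
          intro θ
          rw [map_mul, map_pow, map_mul, hconj, mul_pow, ← Complex.exp_nat_mul,
            ← Complex.exp_nat_mul, ← mul_assoc, mul_assoc, ← Complex.exp_add, conj_ofReal]
          congr 2; push_cast; ring
        simp_rw [this]
        rw [integral_const_mul, integral_exp_int_mul_I]
        rcases Nat.eq_zero_or_pos k with rfl | hk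
        · simp [hc]
        · have : (n : ℤ) + k ≠ 0 := by omega
          simp [this, hk.ne']
      simp_rw [h2] at h
      exact h.unique (hasSum_ite_eq 0 _)
    -- This is `(u + ū - 1) / 2π`. The conjugate contributes only to the moment of index `0`, where
    -- the `-1` cancels it; nonnegativity is `Re q ≥ 1/2`.
    set g : ℝ → ℝ := fun θ => (2 * (u θ).re - 1) / (2 * Real.pi) with hg
    have hgc : Continuous g := by fun_prop
    have hgmom : ∀ n : ℕ, ∫ θ, (g θ : ℂ) * exp (θ * I) ^ n ∂P = c n * ρ ^ n := by
      intro n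
      have hI : ∀ v : ℝ → ℂ, Continuous v → Integrable v P := fun v hv =>
        (hv.continuousOn.integrableOn_Icc (a := 0) (b := 2 * Real.pi)).mono_set
          Set.Ioc_subset_Icc_self
      have : ∀ θ, (g θ : ℂ) * exp (θ * I) ^ n = (1 / (2 * Real.pi)) *
          (u θ * exp (θ * I) ^ n + (starRingEnd ℂ) (u θ) * exp (θ * I) ^ n - exp (θ * I) ^ n) := by
        intro θ
        have h3 := Complex.add_conj (u θ)
        have h4 : (starRingEnd ℂ) (u θ) = 2 * ((u θ).re : ℂ) - u θ := by
          push_cast at h3; rw [← h3]; ring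
        rw [h4, hg]; push_cast; ring
      simp_rw [this]
      have hcc : Continuous fun θ => (starRingEnd ℂ) (u θ) := continuous_conj.comp hucont
      rw [integral_const_mul, integral_sub (hI _ (by fun_prop)) (hI _ (by fun_prop)),
        integral_add (hI _ (by fun_prop)) (hI _ (by fun_prop)), e0, e1, e2]
      have : (Real.pi : ℂ) ≠ 0 := by exact_mod_cast Real.pi_ne_zero
      field_simp
      ring
    have hg1 : ∫ θ, g θ ∂P = 1 := by
      have := hgmom 0
      simp only [pow_zero, mul_one, hc] at this
      rw [integral_complex_ofReal] at this
      exact_mod_cast this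
    have hgI : Integrable g P :=
      (hgc.continuousOn.integrableOn_Icc (a := 0) (b := 2 * Real.pi)).mono_set
        Set.Ioc_subset_Icc_self
    obtain ⟨ν, hν⟩ := exists_circleMoment_eq_integral (P := P) hgc.measurable hgI
      (fun θ => div_nonneg (by linarith [hre _ (hn θ)]) Real.two_pi_pos.le) hg1
      (φ := fun θ => ⟨exp (θ * I), by simp [norm_exp_ofReal_mul_I]⟩)
      (Continuous.measurable (by fun_prop))
    exact ⟨ν, funext fun n => (hν n).trans (hgmom n)⟩
  have hlim : Tendsto (fun ρ : ℝ => fun n => c n * (ρ : ℂ) ^ n) (𝓝[<] 1) (𝓝 c) := by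
    rw [tendsto_pi_nhds]
    intro n
    have : Continuous fun ρ : ℝ => c n * (ρ : ℂ) ^ n := by fun_prop
    have h := this.tendsto 1
    simp only [ofReal_one, one_pow, mul_one] at h
    exact h.mono_left nhdsWithin_le_nhds
  refine isClosed_range_circleMoment.mem_of_tendsto hlim ?_
  filter_upwards [Ioo_mem_nhdsLT (zero_lt_one' ℝ)] with ρ hρ
  exact key ρ hρ.1.le hρ.2

/-! ### The recursion satisfied by the coefficients of `f'` -/

theorem half_lt_re_inv_one_sub {v : ℂ} (hv : ‖v‖ < 1) : 1 / 2 < ((1 - v)⁻¹).re := by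
  have h1 : v.re * v.re + v.im * v.im < 1 := by
    rw [← Complex.normSq_apply, Complex.normSq_eq_norm_sq]
    nlinarith [norm_nonneg v]
  have h2 : 0 < normSq (1 - v) := by
    rw [Complex.normSq_pos]
    intro h
    rw [← sub_eq_zero.1 h] at hv
    simp at hv
  rw [Complex.inv_re, lt_div_iff₀ h2, Complex.normSq_apply]
  simp
  nlinarith

/-- Balayage: mass in the closed disk can be swept to the circle without changing its moments. The
generating function is an average of `(1 - w z)⁻¹` with `‖w z‖ < 1`, each of real part above `1/2`,
so Herglotz applies. -/
theorem exists_circleMoment_eq_integral_of_norm_le_one {Ω : Type*} [MeasurableSpace Ω]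
    {P : Measure Ω} [IsFiniteMeasure P] {g : Ω → ℝ} (hgm : Measurable g) {B : ℝ}
    (hg0 : ∀ ω, 0 ≤ g ω) (hgB : ∀ ω, g ω ≤ B) (hg1 : ∫ ω, g ω ∂P = 1) {w : Ω → ℂ}
    (hwm : Measurable w) (hw : ∀ ω, ‖w ω‖ ≤ 1) :
    ∃ ν, ∀ n, circleMoment ν n = ∫ ω, (g ω : ℂ) * w ω ^ n ∂P := by
  have hgB' : ∀ ω, ‖(g ω : ℂ)‖ ≤ B := fun ω => by simpa [abs_of_nonneg (hg0 ω)] using hgB ω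
  have hwz : ∀ z : ℂ, ‖z‖ < 1 → ∀ ω, ‖w ω * z‖ < 1 := fun z hz ω => by
    rw [norm_mul]
    exact (mul_le_of_le_one_left (norm_nonneg z) (hw ω)).trans_lt hz
  have hS : ∀ z : ℂ, ‖z‖ < 1 → HasSum (fun n => (∫ ω, (g ω : ℂ) * w ω ^ n ∂P) * z ^ n)
      (∫ ω, (g ω : ℂ) * (1 - w ω * z)⁻¹ ∂P) := by
    intro z hz
    have h := hasSum_integral_of_norm_le (P := P) (B := fun n => B * ‖z‖ ^ n)
      (F := fun n ω => (g ω : ℂ) * w ω ^ n * z ^ n)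
      (G := fun ω => (g ω : ℂ) * (1 - w ω * z)⁻¹)
      (fun n => by fun_prop) ((summable_geometric_of_lt_one (norm_nonneg z) hz).mul_left B)
      (fun n ω => by
        rw [mul_assoc, ← mul_pow, norm_mul, norm_pow, norm_mul]
        gcongr
        · exact (norm_nonneg _).trans (hgB' ω)
        · exact hgB' ω
        · exact mul_le_of_le_one_left (norm_nonneg z) (hw ω))
      (fun ω => by
        simp_rw [mul_assoc, ← mul_pow]
        exact (hasSum_geometric_of_norm_lt_one (hwz z hz ω)).mul_left _)
    simp_rw [integral_mul_const] at h
    exact h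
  suffices hre : ∀ z : ℂ, ‖z‖ < 1 → 1 / 2 ≤ (∫ ω, (g ω : ℂ) * (1 - w ω * z)⁻¹ ∂P).re by
    obtain ⟨ν, hν⟩ := exists_circleMoment_eq_of_half_le_re
      (c := fun n => ∫ ω, (g ω : ℂ) * w ω ^ n ∂P) (by simp [integral_complex_ofReal, hg1]) hS hre
    exact ⟨ν, fun n => congrFun hν n⟩
  intro z hz
  have hint : Integrable (fun ω => (g ω : ℂ) * (1 - w ω * z)⁻¹) P := by
    refine integrable_of_norm_le (B := B * (1 - ‖z‖)⁻¹) (by fun_prop) fun ω => ?_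
    rw [norm_mul, norm_inv]
    have h1 : 1 - ‖z‖ ≤ ‖1 - w ω * z‖ := by
      have h2 := norm_sub_norm_le (1 : ℂ) (w ω * z)
      rw [norm_one, norm_mul] at h2
      linarith [mul_le_of_le_one_left (norm_nonneg z) (hw ω)]
    have h3 : 0 < 1 - ‖z‖ := by linarith
    gcongr
    · exact (norm_nonneg _).trans (hgB' ω)
    · exact hgB' ω
  have hgI : Integrable g P := integrable_of_norm_le (B := B) (by fun_prop) fun ω => by
    simpa using hgB' ω
  calc (1 / 2 : ℝ) = ∫ ω, g ω * (1 / 2) ∂P := by rw [integral_mul_const, hg1, one_mul]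
    _ ≤ ∫ ω, ((g ω : ℂ) * (1 - w ω * z)⁻¹).re ∂P := by
        refine integral_mono (hgI.mul_const _) hint.re fun ω => ?_
        simp only [re_ofReal_mul]
        exact mul_le_mul_of_nonneg_left (half_lt_re_inv_one_sub (hwz z hz ω)).le (hg0 ω)
    _ = _ := by
        exact integral_re hint

theorem integral_pow_mul_one_sub_pow (j k : ℕ) :
    ∫ b : unitInterval, ((b : ℝ) : ℂ) ^ j * (1 - ((b : ℝ) : ℂ)) ^ k =
      (j.factorial * k.factorial : ℂ) / (j + k + 1).factorial := by
  have h1 := Complex.Gamma_mul_Gamma_eq_betaIntegral (s := (j : ℂ) + 1) (t := (k : ℂ) + 1)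
    (by simp; positivity) (by simp; positivity)
  rw [Complex.Gamma_nat_eq_factorial, Complex.Gamma_nat_eq_factorial,
    show (j : ℂ) + 1 + ((k : ℂ) + 1) = ((j + k + 1 : ℕ) : ℂ) + 1 by push_cast; ring,
    Complex.Gamma_nat_eq_factorial] at h1
  have h2 : Complex.betaIntegral ((j : ℂ) + 1) ((k : ℂ) + 1) =
      ∫ b : unitInterval, ((b : ℝ) : ℂ) ^ j * (1 - ((b : ℝ) : ℂ)) ^ k := by
    rw [Complex.betaIntegral, intervalIntegral.integral_of_le zero_le_one,
      ← integral_Icc_eq_integral_Ioc]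
    symm
    simp only [add_sub_cancel_right, cpow_natCast]
    exact integral_subtype (s := Set.Icc (0 : ℝ) 1) measurableSet_Icc
      (fun b : ℝ => (b : ℂ) ^ j * (1 - (b : ℂ)) ^ k)
  rw [← h2, h1, mul_div_cancel_left₀]
  exact_mod_cast Nat.factorial_ne_zero _

/-- If `x`, `u` and `b` are independent with laws `μ`, `ν` and `Beta(1, 3)`, the law of
`b x + (1 - b) u` has, up to balayage to the circle, the moments on the right-hand side. -/
theorem exists_circleMoment_mix (μ ν : ProbabilityMeasure unitSphere) :
    ∃ ξ, ∀ n, (((n + 3).choose 3 : ℕ) : ℂ) * circleMoment ξ n =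
      ∑ k ∈ Finset.range (n + 1),
        (((k + 2).choose 2 : ℕ) : ℂ) * circleMoment ν k * circleMoment μ (n - k) := by
  set P : Measure (unitInterval × unitSphere × unitSphere) :=
    (volume : Measure unitInterval).prod
      ((μ : Measure unitSphere).prod (ν : Measure unitSphere)) with hP
  have hprod : ∀ (j k : ℕ) (a : unitInterval → ℂ),
      ∫ ω, a ω.1 * ((ω.2.1 : ℂ) ^ j * (ω.2.2 : ℂ) ^ k) ∂P =
        (∫ b, a b) * (circleMoment μ j * circleMoment ν k) := by
    intro j k a
    rw [hP, integral_prod_mul (f := a)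
      (g := fun y : unitSphere × unitSphere => (y.1 : ℂ) ^ j * (y.2 : ℂ) ^ k)]
    congr 1
    exact integral_prod_mul (f := fun x : unitSphere => (x : ℂ) ^ j)
      (g := fun x : unitSphere => (x : ℂ) ^ k)
  -- After binomial expansion, `3 C(n, k) ∫ b^(n-k) (1 - b)^(k+2) db` is a Beta integral equal to
  -- `C(k+2, 2) / C(n+3, 3)`. The factor `3` normalizes the density.
  have hmom : ∀ n, ∫ ω, ((3 * (1 - (ω.1 : ℝ)) ^ 2 : ℝ) : ℂ) *
      (((1 - (ω.1 : ℝ) : ℝ) : ℂ) * ω.2.2 + ((ω.1 : ℝ) : ℂ) * ω.2.1) ^ n ∂P =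
      (∑ k ∈ Finset.range (n + 1),
        (((k + 2).choose 2 : ℕ) : ℂ) * circleMoment ν k * circleMoment μ (n - k)) /
          (((n + 3).choose 3 : ℕ) : ℂ) := by
    intro n
    have hexp : ∀ ω : unitInterval × unitSphere × unitSphere,
        ((3 * (1 - (ω.1 : ℝ)) ^ 2 : ℝ) : ℂ) *
          (((1 - (ω.1 : ℝ) : ℝ) : ℂ) * ω.2.2 + ((ω.1 : ℝ) : ℂ) * ω.2.1) ^ n =
        ∑ k ∈ Finset.range (n + 1), (3 * (n.choose k : ℂ) *
          (((ω.1 : ℝ) : ℂ) ^ (n - k) * (1 - ((ω.1 : ℝ) : ℂ)) ^ (k + 2))) *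
            ((ω.2.1 : ℂ) ^ (n - k) * (ω.2.2 : ℂ) ^ k) := by
      intro ω
      rw [add_pow, Finset.mul_sum]
      refine Finset.sum_congr rfl fun k _ => ?_
      push_cast
      rw [mul_pow, mul_pow, pow_add (1 - ((ω.1 : ℝ) : ℂ)) k 2]
      generalize (1 - ((ω.1 : ℝ) : ℂ)) = t
      ring
    simp_rw [hexp]
    rw [integral_finsetSum]
    · rw [Finset.sum_div]
      refine Finset.sum_congr rfl fun k hk => ?_
      obtain ⟨j, rfl⟩ := Nat.exists_eq_add_of_le (Nat.lt_succ_iff.1 (Finset.mem_range.1 hk))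
      rw [Nat.add_sub_cancel_left, hprod j k (fun b => 3 * ((k + j).choose k : ℂ) *
          (((b : ℝ) : ℂ) ^ j * (1 - ((b : ℝ) : ℂ)) ^ (k + 2))), integral_const_mul,
        integral_pow_mul_one_sub_pow]
      rw [Nat.cast_choose ℂ (Nat.le_add_right k j), Nat.cast_choose ℂ (Nat.le_add_left 2 k),
        Nat.cast_choose ℂ (Nat.le_add_left 3 (k + j)), Nat.add_sub_cancel_left,
        Nat.add_sub_cancel, Nat.add_sub_cancel, show j + (k + 2) + 1 = k + j + 3 by ring]
      have h : ∀ m : ℕ, (m.factorial : ℂ) ≠ 0 := fun m => by exact_mod_cast m.factorial_ne_zero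
      have h3 : ((3).factorial : ℂ) = 6 := by norm_num [Nat.factorial]
      have h2 : ((2).factorial : ℂ) = 2 := by norm_num [Nat.factorial]
      have := h j
      have := h k
      have := h (k + j)
      have := h (k + j + 3)
      rw [h2, h3]
      field_simp
      ring
    · intro k _
      exact Continuous.integrable_of_hasCompactSupport (by fun_prop)
        (HasCompactSupport.of_compactSpace _)
  obtain ⟨ξ, hξ⟩ := exists_circleMoment_eq_integral_of_norm_le_one (P := P)
    (g := fun ω => 3 * (1 - (ω.1 : ℝ)) ^ 2) (B := 3) (by fun_prop) (fun ω => by positivity)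
    (fun ω => by nlinarith [ω.1.2.1, ω.1.2.2]) (by
      have h := hmom 0
      simp only [pow_zero, mul_one] at h
      rw [integral_complex_ofReal] at h
      simp [circleMoment_zero] at h
      exact_mod_cast h)
    (w := fun ω => ((1 - (ω.1 : ℝ) : ℝ) : ℂ) * ω.2.2 + ((ω.1 : ℝ) : ℂ) * ω.2.1) (by fun_prop)
    (fun ω => by
      refine (norm_add_le _ _).trans ?_
      rw [norm_mul, norm_mul, norm_coe_unitSphere, norm_coe_unitSphere, norm_real, norm_real,
        Real.norm_of_nonneg ω.1.2.1, Real.norm_of_nonneg (sub_nonneg.2 ω.1.2.2)]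
      simp)
  refine ⟨ξ, fun n => ?_⟩
  rw [hξ, hmom, mul_div_cancel₀]
  exact_mod_cast (Nat.choose_pos (Nat.le_add_left 3 n)).ne'

theorem sum_range_choose_two (n : ℕ) :
    ∑ k ∈ Finset.range (n + 1), (k + 2).choose 2 = (n + 3).choose 3 := by
  induction n with
  | zero => rfl
  | succ n ih => rw [Finset.sum_range_succ, ih, Nat.choose_succ_succ (n + 3) 2]; ring

/-- A sequence determined by the recursion of `exists_circleMoment_mix` with `ξ = ν` is a
moment sequence. -/
theorem exists_circleMoment_eq_of_recursion (μ : ProbabilityMeasure unitSphere) {c : ℕ → ℂ}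
    (hc0 : c 0 = 1)
    (hc : ∀ n, (((n + 3).choose 3 : ℕ) : ℂ) * c n = ∑ k ∈ Finset.range (n + 1),
      (((k + 2).choose 2 : ℕ) : ℂ) * c k * circleMoment μ (n - k)) :
    ∃ ν, circleMoment ν = c := by
  choose T hT using exists_circleMoment_mix μ
  set ξ : ℕ → ProbabilityMeasure unitSphere := fun i => T^[i] μ with hξ
  have hξs : ∀ i, ξ (i + 1) = T (ξ i) := fun i => Function.iterate_succ_apply' T i μ
  have hlim : Tendsto (fun i => circleMoment (ξ i)) atTop (𝓝 c) := by
    rw [tendsto_pi_nhds]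
    intro N
    set A : ℝ := (((N + 3).choose 3 : ℕ) : ℝ) with hA
    have hA1 : 1 ≤ A := by
      rw [hA]; exact_mod_cast Nat.choose_pos (Nat.le_add_left 3 N)
    set D : ℝ := ∑ k ∈ Finset.range (N + 1), ‖circleMoment (ξ 0) k - c k‖ with hD
    have hD0 : 0 ≤ D := Finset.sum_nonneg fun _ _ => norm_nonneg _
    have hq0 : 0 ≤ 1 - 1 / A := by
      rw [sub_nonneg, div_le_one (by linarith)]; exact hA1
    have hq1 : 1 - 1 / A < 1 := by
      have : 0 < 1 / A := by positivity
      linarith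
    -- The rate depends only on the cutoff `N`, since the moment of index `n` of the next iterate
    -- involves only indices up to `n`.
    have key : ∀ i n, n ≤ N → ‖circleMoment (ξ i) n - c n‖ ≤ D * (1 - 1 / A) ^ i := by
      intro i
      induction i with
      | zero =>
        intro n hn
        rw [pow_zero, mul_one]
        exact Finset.single_le_sum (f := fun k => ‖circleMoment (ξ 0) k - c k‖)
          (fun _ _ => norm_nonneg _) (Finset.mem_range.2 (Nat.lt_succ_of_le hn))
      | succ i ih =>
        intro n hn
        set M : ℝ := D * (1 - 1 / A) ^ i with hM
        have hM0 : 0 ≤ M := by positivity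
        set a : ℝ := (((n + 3).choose 3 : ℕ) : ℝ) with ha
        have ha1 : 1 ≤ a := by
          rw [ha]; exact_mod_cast Nat.choose_pos (Nat.le_add_left 3 n)
        have haA : a ≤ A := by
          rw [ha, hA]; exact_mod_cast Nat.choose_le_choose 3 (by omega)
        -- The term `k = 0` drops out because both sequences start with `1`. It has weight `1` out
        -- of the total `a`, which yields the contraction factor `(a - 1) / a`.
        have h1 : (a : ℂ) * (circleMoment (ξ (i + 1)) n - c n) =
            ∑ k ∈ Finset.range n, (((k + 1 + 2).choose 2 : ℕ) : ℂ) *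
              (circleMoment (ξ i) (k + 1) - c (k + 1)) * circleMoment μ (n - (k + 1)) := by
          rw [mul_sub, ha, ofReal_natCast, hξs, hT, hc, ← Finset.sum_sub_distrib,
            Finset.sum_range_succ']
          simp only [circleMoment_zero, hc0, sub_self, add_zero]
          exact Finset.sum_congr rfl fun k _ => by ring
        have h2 : a * ‖circleMoment (ξ (i + 1)) n - c n‖ ≤ (a - 1) * M := by
          calc a * ‖circleMoment (ξ (i + 1)) n - c n‖
              = ‖(a : ℂ) * (circleMoment (ξ (i + 1)) n - c n)‖ := by
                rw [norm_mul, norm_real, Real.norm_of_nonneg (by linarith)]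
            _ ≤ ∑ k ∈ Finset.range n, (((k + 1 + 2).choose 2 : ℕ) : ℝ) * M := by
                rw [h1]
                refine norm_sum_le_of_le _ fun k hk => ?_
                rw [norm_mul, norm_mul, norm_natCast]
                have := ih (k + 1) (by have := Finset.mem_range.1 hk; omega)
                calc _ ≤ (((k + 1 + 2).choose 2 : ℕ) : ℝ) * M * 1 := by
                      gcongr
                      exact norm_circleMoment_le _ _
                  _ = _ := mul_one _
            _ = (a - 1) * M := by
                rw [← Finset.sum_mul, ha, ← sum_range_choose_two, Finset.sum_range_succ']
                simp
        rw [pow_succ, ← mul_assoc, ← hM]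
        have h3 : ‖circleMoment (ξ (i + 1)) n - c n‖ ≤ M * (1 - 1 / a) := by
          rw [show M * (1 - 1 / a) = (a - 1) * M / a by field_simp, le_div_iff₀ (by linarith)]
          linarith
        refine h3.trans ?_
        gcongr
    rw [tendsto_iff_norm_sub_tendsto_zero]
    refine squeeze_zero (fun _ => norm_nonneg _) (fun i => key i N le_rfl) ?_
    simpa using (tendsto_pow_atTop_nhds_zero_of_lt_one hq0 hq1).const_mul D
  exact isClosed_range_circleMoment.mem_of_tendsto hlim (Eventually.of_forall fun i => ⟨ξ i, rfl⟩)

/-- The recursion of `exists_circleMoment_eq_of_recursion` for the moments of a point mass. -/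
theorem eq_pow_of_recursion {a : ℂ} {c : ℕ → ℂ} (hc0 : c 0 = 1)
    (hc : ∀ n, (((n + 3).choose 3 : ℕ) : ℂ) * c n = ∑ k ∈ Finset.range (n + 1),
      (((k + 2).choose 2 : ℕ) : ℂ) * c k * a ^ (n - k)) (n : ℕ) : c n = a ^ n := by
  induction n using Nat.strong_induction_on with
  | _ n ih =>
    rcases Nat.eq_zero_or_pos n with rfl | hn
    · simpa using hc0
    have h1 := hc n
    rw [Finset.sum_range_succ, Nat.sub_self, pow_zero, mul_one] at h1
    -- Moving the term `k = n` to the left leaves `c n` with the coefficient `C(n+3, 3) - C(n+2, 2)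
    -- = C(n+2, 3)`, nonzero since `n > 0`.
    have h2 : ∑ k ∈ Finset.range n, (((k + 2).choose 2 : ℕ) : ℂ) * c k * a ^ (n - k) =
        (((n + 2).choose 3 : ℕ) : ℂ) * a ^ n := by
      obtain ⟨m, rfl⟩ := Nat.exists_eq_succ_of_ne_zero hn.ne'
      rw [Nat.succ_eq_add_one, show m + 1 + 2 = m + 3 by ring, ← sum_range_choose_two,
        Nat.cast_sum, Finset.sum_mul]
      refine Finset.sum_congr rfl fun k hk => ?_
      have hk' := Finset.mem_range.1 hk
      rw [ih k hk', mul_assoc, ← pow_add, Nat.add_sub_cancel' hk'.le]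
    rw [h2, Nat.choose_succ_succ (n + 2) 2] at h1
    push_cast at h1
    have h3 : (((n + 2).choose 3 : ℕ) : ℂ) ≠ 0 := by
      exact_mod_cast (Nat.choose_pos (by omega)).ne'
    refine mul_left_cancel₀ h3 ?_
    linear_combination h1

/-! ### Atoms of the representing measure -/

theorem coe_mul_conj_unitSphere (x : unitSphere) : (x : ℂ) * (starRingEnd ℂ) (x : ℂ) = 1 := by
  rw [Complex.mul_conj, Complex.normSq_eq_norm_sq, norm_coe_unitSphere]; simp

theorem hasSum_choose_mul_circleMoment (ν : ProbabilityMeasure unitSphere) (k : ℕ) {z : ℂ}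
    (hz : ‖z‖ < 1) :
    HasSum (fun n => (((n + k).choose k : ℕ) : ℂ) * circleMoment ν n * z ^ n)
      (∫ x : unitSphere, 1 / (1 - (x : ℂ) * z) ^ (k + 1) ∂(ν : Measure unitSphere)) := by
  have hs := (hasSum_choose_mul_geometric_of_norm_lt_one (𝕜 := ℝ) k
    (r := ‖z‖) (by simpa using hz)).summable
  have h := hasSum_integral_of_norm_le (P := (ν : Measure unitSphere))
    (F := fun n x => (((n + k).choose k : ℕ) : ℂ) * (x : ℂ) ^ n * z ^ n)
    (G := fun x : unitSphere => 1 / (1 - (x : ℂ) * z) ^ (k + 1)) (fun n => by fun_prop) hs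
    (fun n x => by simp)
    (fun x => by
      simp_rw [mul_assoc, ← mul_pow]
      exact hasSum_choose_mul_geometric_of_norm_lt_one k (by simpa using hz))
  simp_rw [integral_mul_const, integral_const_mul] at h
  exact h

/-- As `z = r ā` tends radially to the circle, `(1 - r)ᵏ / (1 - x z)ᵏ` is bounded by `1` and tends
to the indicator of `x = a`; dominated convergence isolates the mass of the atom. -/
theorem tendsto_integral_atom (ν : ProbabilityMeasure unitSphere) (a : unitSphere) {k : ℕ}
    (hk : k ≠ 0) :
    Tendsto (fun r : ℝ => (1 - (r : ℂ)) ^ k * ∫ x : unitSphere,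
        1 / (1 - (x : ℂ) * (r * (starRingEnd ℂ) (a : ℂ))) ^ k ∂(ν : Measure unitSphere))
      (𝓝[<] 1) (𝓝 ((ν : Measure unitSphere).real {a} : ℂ)) := by
  have hlim : ∫ x : unitSphere, ({a} : Set unitSphere).indicator (fun _ => (1 : ℂ)) x
      ∂(ν : Measure unitSphere) = ((ν : Measure unitSphere).real {a} : ℂ) := by
    rw [integral_indicator (measurableSet_singleton a), setIntegral_const, real_smul, mul_one]
  rw [← hlim]
  simp_rw [← integral_const_mul]
  have hmem : ∀ᶠ r : ℝ in 𝓝[<] 1, r ∈ Set.Ioo (0 : ℝ) 1 := Ioo_mem_nhdsLT (zero_lt_one' ℝ)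
  refine tendsto_integral_filter_of_dominated_convergence (fun _ => 1)
    (Eventually.of_forall fun r => Measurable.aestronglyMeasurable (by fun_prop)) ?_
    (integrable_const _) (ae_of_all _ fun x => ?_)
  · filter_upwards [hmem] with r hr
    refine ae_of_all _ fun x => ?_
    have h1 : 1 - r ≤ ‖1 - (x : ℂ) * (r * (starRingEnd ℂ) (a : ℂ))‖ := by
      have h2 := norm_sub_norm_le (1 : ℂ) ((x : ℂ) * (r * (starRingEnd ℂ) (a : ℂ)))
      rw [norm_one, norm_mul, norm_mul, RCLike.norm_conj, norm_coe_unitSphere,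
        norm_coe_unitSphere, norm_real, Real.norm_of_nonneg hr.1.le] at h2
      linarith
    have h0 : 0 < 1 - r := by linarith [hr.2]
    have h3 : ‖1 - (r : ℂ)‖ = 1 - r := by
      rw [← ofReal_one, ← ofReal_sub, norm_real, Real.norm_of_nonneg h0.le]
    rw [norm_mul, norm_div, norm_pow, norm_pow, norm_one, h3, mul_one_div]
    exact div_le_one_of_le₀ (pow_le_pow_left₀ h0.le h1 k) (by positivity)
  · by_cases hx : x = a
    · subst hx
      refine Tendsto.congr' ?_ tendsto_const_nhds
      filter_upwards [hmem] with r hr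
      have h0 : 1 - (r : ℂ) ≠ 0 := by
        rw [sub_ne_zero]
        exact_mod_cast hr.2.ne'
      rw [mul_left_comm, coe_mul_conj_unitSphere, mul_one, mul_one_div,
        div_self (pow_ne_zero k h0)]
      simp
    · have hne : 1 - (x : ℂ) * (((1 : ℝ) : ℂ) * (starRingEnd ℂ) (a : ℂ)) ≠ 0 := by
        intro h
        apply hx
        have h2 : (x : ℂ) * (starRingEnd ℂ) (a : ℂ) = 1 := by
          rw [ofReal_one, one_mul] at h
          exact (sub_eq_zero.1 h).symm
        apply Subtype.ext
        calc (x : ℂ) = x * ((a : ℂ) * (starRingEnd ℂ) (a : ℂ)) := by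
              rw [coe_mul_conj_unitSphere, mul_one]
          _ = (x * (starRingEnd ℂ) (a : ℂ)) * a := by ring
          _ = a := by rw [h2, one_mul]
      have hcont : ContinuousAt (fun r : ℝ => (1 - (r : ℂ)) ^ k *
          (1 / (1 - (x : ℂ) * (r * (starRingEnd ℂ) (a : ℂ))) ^ k)) 1 := by
        refine ContinuousAt.mul (by fun_prop) (ContinuousAt.div (by fun_prop) (by fun_prop) ?_)
        exact pow_ne_zero k hne
      have h := hcont.tendsto.mono_left (nhdsWithin_le_nhds (s := Set.Iio 1))
      simpa [hx, hk] using h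

theorem circleMoment_eq_pow_of_ae_eq {ν : ProbabilityMeasure unitSphere} {a : ℂ}
    (h : ∀ᵐ x : unitSphere ∂(ν : Measure unitSphere), (x : ℂ) = a) (n : ℕ) :
    circleMoment ν n = a ^ n := by
  unfold circleMoment
  rw [integral_congr_ae (g := fun _ => a ^ n) (h.mono fun x hx => by simp only [hx])]
  simp

/-- If the recursion has a solution whose measure has an atom, it is a point mass. -/
theorem circleMoment_eq_pow_of_atom {μ ν : ProbabilityMeasure unitSphere}
    (hc : ∀ n, (((n + 3).choose 3 : ℕ) : ℂ) * circleMoment ν n = ∑ k ∈ Finset.range (n + 1),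
      (((k + 2).choose 2 : ℕ) : ℂ) * circleMoment ν k * circleMoment μ (n - k))
    {a : unitSphere} (ha : (ν : Measure unitSphere) {a} ≠ 0) (n : ℕ) :
    circleMoment ν n = (a : ℂ) ^ n := by
  -- The recursion, read as a Cauchy product of generating functions.
  have hid : ∀ z : ℂ, ‖z‖ < 1 →
      ∫ x : unitSphere, 1 / (1 - (x : ℂ) * z) ^ 4 ∂(ν : Measure unitSphere) =
        (∫ x : unitSphere, 1 / (1 - (x : ℂ) * z) ^ 3 ∂(ν : Measure unitSphere)) *
          ∫ x : unitSphere, 1 / (1 - (x : ℂ) * z) ^ 1 ∂(μ : Measure unitSphere) := by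
    intro z hz
    have h3 := hasSum_choose_mul_circleMoment ν 3 hz
    have h2 := hasSum_choose_mul_circleMoment ν 2 hz
    have h1 := hasSum_choose_mul_circleMoment μ 0 hz
    rw [← h3.tsum_eq, ← h2.tsum_eq, ← h1.tsum_eq,
      tsum_mul_tsum_eq_tsum_sum_range_of_summable_norm h2.summable.norm h1.summable.norm]
    refine tsum_congr fun n => ?_
    rw [hc, Finset.sum_mul]
    refine Finset.sum_congr rfl fun k hk => ?_
    have hk' : k ≤ n := Nat.lt_succ_iff.1 (Finset.mem_range.1 hk)
    rw [← pow_mul_pow_sub z hk', Nat.choose_zero_right]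
    push_cast
    ring
  have h4 := tendsto_integral_atom ν a (k := 4) (by norm_num)
  have h3 := tendsto_integral_atom ν a (k := 3) (by norm_num)
  have h1 := tendsto_integral_atom μ a (k := 1) (by norm_num)
  -- Splitting `(1 - r)⁴` as `(1 - r)³ (1 - r)` matches the orders of the two factors, so the limit
  -- reads `ν{a} = ν{a} μ{a}`.
  have h5 := h4.congr' (f₂ := fun r : ℝ => ((1 - (r : ℂ)) ^ 3 * ∫ x : unitSphere,
        1 / (1 - (x : ℂ) * (r * (starRingEnd ℂ) (a : ℂ))) ^ 3 ∂(ν : Measure unitSphere)) *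
      ((1 - (r : ℂ)) ^ 1 * ∫ x : unitSphere,
        1 / (1 - (x : ℂ) * (r * (starRingEnd ℂ) (a : ℂ))) ^ 1 ∂(μ : Measure unitSphere))) (by
    filter_upwards [Ioo_mem_nhdsLT (zero_lt_one' ℝ)] with r hr
    rw [hid _ (by simpa [abs_of_pos hr.1] using hr.2)]
    ring)
  have h6 := tendsto_nhds_unique h5 (h3.mul h1)
  have hne : (((ν : Measure unitSphere).real {a} : ℝ) : ℂ) ≠ 0 := by
    rw [Ne, ofReal_eq_zero, measureReal_eq_zero_iff]
    exact ha
  have h7 : (μ : Measure unitSphere).real {a} = 1 := by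
    have := mul_left_cancel₀ hne (h6.symm.trans (mul_one _).symm)
    exact_mod_cast this
  have h8 : ∀ᵐ x : unitSphere ∂(μ : Measure unitSphere), (x : ℂ) = a := by
    have h9 : (μ : Measure unitSphere) {a} = 1 := by
      rw [← ENNReal.toReal_eq_one_iff]; exact h7
    have h10 : ∀ᵐ x ∂(μ : Measure unitSphere), x ∈ ({a} : Set unitSphere) :=
      (prob_compl_eq_zero_iff (measurableSet_singleton a)).2 h9
    filter_upwards [h10] with x hx
    rw [Set.mem_singleton_iff.1 hx]
  refine eq_pow_of_recursion (circleMoment_zero ν) (fun n => ?_) n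
  simp_rw [hc n, circleMoment_eq_pow_of_ae_eq h8]

/-! ### Taylor coefficients of functions in the disk -/

theorem mem_unitDisk {z : ℂ} : z ∈ unitDisk ↔ ‖z‖ < 1 := mem_ball_zero_iff

theorem hasSum_taylor_unitDisk {g : ℂ → ℂ} (hg : DifferentiableOn ℂ g unitDisk) {z : ℂ}
    (hz : ‖z‖ < 1) :
    HasSum (fun n => iteratedDeriv n g 0 / (n.factorial : ℂ) * z ^ n) (g z) := by
  have h := Complex.hasSum_taylorSeries_on_ball hg (mem_unitDisk.2 hz)
  refine h.congr_fun fun n => ?_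
  simp only [sub_zero, smul_eq_mul]
  ring

theorem coeff_unique_of_hasSum {g : ℂ → ℂ} {a b : ℕ → ℂ}
    (ha : ∀ z : ℂ, ‖z‖ < 1 → HasSum (fun n => a n * z ^ n) (g z))
    (hb : ∀ z : ℂ, ‖z‖ < 1 → HasSum (fun n => b n * z ^ n) (g z)) : a = b := by
  have key : ∀ c : ℕ → ℂ, (∀ z : ℂ, ‖z‖ < 1 → HasSum (fun n => c n * z ^ n) (g z)) →
      HasFPowerSeriesAt g (FormalMultilinearSeries.ofScalars ℂ c) 0 := by
    intro c hc
    rw [hasFPowerSeriesAt_iff]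
    filter_upwards [Metric.ball_mem_nhds (0 : ℂ) one_pos] with z hz
    simpa [mul_comm] using hc z (mem_unitDisk.1 hz)
  have h := (key a ha).eq_formalMultilinearSeries (key b hb)
  funext n
  have h2 := congrArg (fun p : FormalMultilinearSeries ℂ ℂ ℂ => p.coeff n) h
  simpa using h2

theorem diskExt_add (f g : C(unitDisk, ℂ)) : diskExt (f + g) = diskExt f + diskExt g := by
  funext z
  by_cases hz : z ∈ unitDisk <;>
    simp only [diskExt, hz, dite_true, dite_false, Pi.add_apply, ContinuousMap.add_apply, add_zero]

theorem diskExt_smul (c : ℂ) (f : C(unitDisk, ℂ)) : diskExt (c • f) = c • diskExt f := by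
  funext z
  by_cases hz : z ∈ unitDisk <;> simp [diskExt]

theorem analyticOnNhd_diskExt (f : AnalyticDisk) : AnalyticOnNhd ℂ (diskExt f) unitDisk := f.2

theorem analyticOnNhd_iteratedDeriv_diskExt (f : AnalyticDisk) (n : ℕ) :
    AnalyticOnNhd ℂ (iteratedDeriv n (diskExt f)) unitDisk := by
  rw [iteratedDeriv_eq_iterate]
  exact (analyticOnNhd_diskExt f).iterated_deriv n

theorem tendstoLocallyUniformlyOn_diskExt (f : AnalyticDisk) :
    TendstoLocallyUniformlyOn (fun g : AnalyticDisk => diskExt g) (diskExt f) (𝓝 f) unitDisk := by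
  have hlc : LocallyCompactSpace unitDisk := Metric.isOpen_ball.locallyCompactSpace
  have h : Tendsto (fun g : AnalyticDisk => (g : C(unitDisk, ℂ))) (𝓝 f) (𝓝 (f : C(unitDisk, ℂ))) :=
    continuous_subtype_val.tendsto f
  rw [ContinuousMap.tendsto_iff_tendstoLocallyUniformly] at h
  rw [tendstoLocallyUniformlyOn_iff_tendstoLocallyUniformly_comp_coe]
  have e : ∀ (g : AnalyticDisk) (z : unitDisk), diskExt (g : C(unitDisk, ℂ)) z =
      (g : C(unitDisk, ℂ)) z := fun g z => diskExt_of_mem _ z.2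
  refine (h.congr_right (g := fun z : unitDisk => diskExt f z) fun z => (e f z).symm).congr fun g z => ?_
  exact (e g z).symm

theorem tendstoLocallyUniformlyOn_iteratedDeriv_diskExt (f : AnalyticDisk) (n : ℕ) :
    TendstoLocallyUniformlyOn (fun g : AnalyticDisk => iteratedDeriv n (diskExt g))
      (iteratedDeriv n (diskExt f)) (𝓝 f) unitDisk := by
  induction n with
  | zero => simpa using tendstoLocallyUniformlyOn_diskExt f
  | succ n ih =>
    simp_rw [iteratedDeriv_succ]
    exact ih.deriv (Eventually.of_forall fun g =>
      (analyticOnNhd_iteratedDeriv_diskExt g n).differentiableOn) Metric.isOpen_ball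

/-- The `n`-th Taylor coefficient at `0`, as a continuous linear functional. -/
noncomputable def diskCoeff (n : ℕ) : AnalyticDisk →L[ℂ] ℂ where
  toFun f := iteratedDeriv n (diskExt f) 0 / (n.factorial : ℂ)
  map_add' f g := by
    have h : ∀ k : AnalyticDisk, ContDiffAt ℂ n (diskExt k) 0 := fun k =>
      (analyticOnNhd_diskExt k 0 (by simp)).contDiffAt
    rw [Submodule.coe_add, diskExt_add, iteratedDeriv_add (h f) (h g), add_div]
  map_smul' c f := by
    have h : ContDiffAt ℂ n (diskExt f) 0 := (analyticOnNhd_diskExt f 0 (by simp)).contDiffAt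
    rw [Submodule.coe_smul, diskExt_smul, iteratedDeriv_const_smul h c]
    simp [mul_div_assoc]
  cont := by
    refine Continuous.div_const ?_ _
    rw [continuous_iff_continuousAt]
    intro f
    exact (tendstoLocallyUniformlyOn_iteratedDeriv_diskExt f n).tendsto_at (by simp)

theorem diskCoeff_apply (n : ℕ) (f : AnalyticDisk) :
    diskCoeff n f = iteratedDeriv n (diskExt f) 0 / (n.factorial : ℂ) := rfl

theorem hasSum_diskCoeff (f : AnalyticDisk) {z : ℂ} (hz : ‖z‖ < 1) :
    HasSum (fun n => diskCoeff n f * z ^ n) (diskExt f z) :=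
  hasSum_taylor_unitDisk (analyticOnNhd_diskExt f).differentiableOn hz

theorem diskCoeff_eq_of_hasSum {f : AnalyticDisk} {a : ℕ → ℂ}
    (ha : ∀ z : ℂ, ‖z‖ < 1 → HasSum (fun n => a n * z ^ n) (diskExt f z)) (n : ℕ) :
    diskCoeff n f = a n :=
  congrFun (coeff_unique_of_hasSum (fun _ hz => hasSum_diskCoeff f hz) ha) n

theorem AnalyticDisk.ext_diskCoeff {f g : AnalyticDisk} (h : ∀ n, diskCoeff n f = diskCoeff n g) :
    f = g := by
  apply Subtype.ext
  ext z
  have hz : ‖(z : ℂ)‖ < 1 := mem_unitDisk.1 z.2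
  have h1 := hasSum_diskCoeff f hz
  simp_rw [h] at h1
  have h2 := h1.unique (hasSum_diskCoeff g hz)
  rwa [diskExt_of_mem _ z.2, diskExt_of_mem _ z.2] at h2

theorem exists_diskCoeff_eq {a : ℕ → ℂ}
    (ha : ∀ r : ℝ, 0 ≤ r → r < 1 → Summable fun n => ‖a n‖ * r ^ n) :
    ∃ f : AnalyticDisk, ∀ n, diskCoeff n f = a n := by
  set p := FormalMultilinearSeries.ofScalars ℂ a with hp
  have hr : 1 ≤ p.radius := by
    refine ENNReal.le_of_forall_nnreal_lt fun r hr => ?_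
    refine p.le_radius_of_summable_norm ?_
    have hr' : (r : ℝ) < 1 := by exact_mod_cast hr
    refine (ha r r.2 hr').of_nonneg_of_le (fun n => by positivity) fun n => ?_
    gcongr
    rw [hp]
    exact (FormalMultilinearSeries.ofScalars_norm ..).le
  have hp1 := (p.hasFPowerSeriesOnBall (one_pos.trans_le hr)).mono one_pos hr
  have han : AnalyticOnNhd ℂ p.sum unitDisk := by
    have := hp1.analyticOnNhd
    rwa [← ENNReal.ofReal_one, Metric.eball_ofReal] at this
  have hcont : Continuous fun z : unitDisk => p.sum z :=
    continuousOn_iff_continuous_domRestrict.1 han.continuousOn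
  have heq : ∀ z ∈ unitDisk, diskExt ⟨fun z : unitDisk => p.sum z, hcont⟩ z = p.sum z :=
    fun z hz => diskExt_of_mem _ hz
  refine ⟨⟨⟨fun z : unitDisk => p.sum z, hcont⟩,
    han.congr Metric.isOpen_ball fun z hz => (heq z hz).symm⟩, fun n => ?_⟩
  refine diskCoeff_eq_of_hasSum (fun z hz => ?_) n
  rw [heq z (mem_unitDisk.2 hz)]
  have h := hp1.hasSum (y := z) (by
    rw [← ENNReal.ofReal_one, Metric.eball_ofReal]; exact mem_unitDisk.2 hz)
  simpa [hp, mul_comm] using h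

theorem summable_linear_mul_pow {b : ℕ → ℂ} (hb : ∀ n, ‖b n‖ ≤ n + 1) (r : ℝ) (h0 : 0 ≤ r)
    (h1 : r < 1) : Summable fun n => ‖b n‖ * r ^ n := by
  have h := (hasSum_choose_mul_geometric_of_norm_lt_one (𝕜 := ℝ) 1
    (r := r) (by simpa [abs_of_nonneg h0] using h1)).summable
  refine h.of_nonneg_of_le (fun n => by positivity) fun n => ?_
  gcongr
  simpa using hb n

/-! ### The functions represented by measures on the circle -/

/-- `f` is represented by `ν`: formally, `f = ∫ extremalFun x dν(x)`. -/
def IsRepresentedBy (f : AnalyticDisk) (ν : ProbabilityMeasure unitSphere) : Prop :=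
  diskCoeff 0 f = 0 ∧ ∀ n : ℕ, diskCoeff (n + 1) f = ((n : ℂ) + 2) / 2 * circleMoment ν n

/-- The class of all functions represented by probability measures on the circle. -/
def momentClass : Set AnalyticDisk := {f | ∃ ν, IsRepresentedBy f ν}

theorem exists_isRepresentedBy (ν : ProbabilityMeasure unitSphere) :
    ∃ f, IsRepresentedBy f ν := by
  obtain ⟨f, hf⟩ := exists_diskCoeff_eq
    (a := fun n => if n = 0 then 0 else ((n : ℂ) + 1) / 2 * circleMoment ν (n - 1))
    (summable_linear_mul_pow fun n => by
      split_ifs with h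
      · simp; positivity
      · rw [norm_mul]
        have h1 : ‖((n : ℂ) + 1) / 2‖ ≤ n + 1 := by
          rw [norm_div, ← Nat.cast_add_one, norm_natCast]
          push_cast
          simp only [RCLike.norm_ofNat]
          linarith [Nat.cast_nonneg (α := ℝ) n]
        calc _ ≤ ((n : ℝ) + 1) * 1 := by
              gcongr
              exact norm_circleMoment_le _ _
          _ = _ := mul_one _)
  refine ⟨f, by simp [hf], fun n => ?_⟩
  rw [hf, if_neg n.succ_ne_zero, Nat.add_sub_cancel]
  push_cast
  ring

theorem isClosed_momentClass : IsClosed momentClass := by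
  have h : momentClass = {f | diskCoeff 0 f = 0} ∩
      (fun f n => diskCoeff (n + 1) f / (((n : ℂ) + 2) / 2)) ⁻¹' Set.range circleMoment := by
    ext f
    constructor
    · rintro ⟨ν, h0, hn⟩
      refine ⟨h0, ν, funext fun n => ?_⟩
      have : ((n : ℂ) + 2) / 2 ≠ 0 := div_ne_zero (by exact_mod_cast (n + 1).succ_ne_zero) two_ne_zero
      simp only [hn]
      rw [mul_div_cancel_left₀ _ this]
    · rintro ⟨h0, ν, hν⟩
      refine ⟨ν, h0, fun n => ?_⟩
      have : ((n : ℂ) + 2) / 2 ≠ 0 := div_ne_zero (by exact_mod_cast (n + 1).succ_ne_zero) two_ne_zero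
      rw [congrFun hν n, mul_div_cancel₀ _ this]
  rw [h]
  refine IsClosed.inter (isClosed_eq (by fun_prop) continuous_const)
    (isClosed_range_circleMoment.preimage ?_)
  exact continuous_pi fun n => (diskCoeff (n + 1)).continuous.div_const _

theorem convex_momentClass : Convex ℝ momentClass := by
  rintro f ⟨ν, hν0, hν⟩ g ⟨ξ, hξ0, hξ⟩ s t hs ht hst
  have hmix : ∃ η, ∀ n, circleMoment η n = s * circleMoment ν n + t * circleMoment ξ n := by
    set Q : Measure unitSphere := ENNReal.ofReal s • (ν : Measure unitSphere) +
      ENNReal.ofReal t • (ξ : Measure unitSphere) with hQ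
    have hQp : IsProbabilityMeasure Q := ⟨by
      simp [hQ, ← ENNReal.ofReal_add hs ht, hst]⟩
    refine ⟨⟨Q, hQp⟩, fun n => ?_⟩
    unfold circleMoment
    rw [ProbabilityMeasure.coe_mk, hQ, integral_add_measure
      ((integrable_pow_unitSphere _ n).smul_measure ENNReal.ofReal_ne_top)
      ((integrable_pow_unitSphere _ n).smul_measure ENNReal.ofReal_ne_top),
      integral_smul_measure, integral_smul_measure, ENNReal.toReal_ofReal hs,
      ENNReal.toReal_ofReal ht]
    simp
  obtain ⟨η, hη⟩ := hmix
  have hlin : ∀ n, diskCoeff n (s • f + t • g) = s * diskCoeff n f + t * diskCoeff n g := by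
    intro n
    rw [map_add, ContinuousLinearMap.map_smul_of_tower, ContinuousLinearMap.map_smul_of_tower]
    rfl
  refine ⟨η, by rw [hlin, hν0, hξ0]; simp, fun n => ?_⟩
  rw [hlin, hν, hξ, hη]
  ring

/-! ### The class `𝓖` and its extremal functions -/

/-- The recursion linking `ν` to the Herglotz measure `μ` is kept in the conclusion: membership in
the convex hull needs only `ν`, but the support-point argument needs both. -/
theorem exists_isRepresentedBy_of_mem_classG {f : AnalyticDisk} (hf : f ∈ classG) :
    ∃ μ ν : ProbabilityMeasure unitSphere, IsRepresentedBy f ν ∧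
      ∀ n, (((n + 3).choose 3 : ℕ) : ℂ) * circleMoment ν n = ∑ k ∈ Finset.range (n + 1),
        (((k + 2).choose 2 : ℕ) : ℂ) * circleMoment ν k * circleMoment μ (n - k) := by
  obtain ⟨⟨hf0, hf1⟩, hfG⟩ := hf
  set h : ℂ → ℂ := deriv (diskExt f) with hh
  have hhA : AnalyticOnNhd ℂ h unitDisk := (analyticOnNhd_diskExt f).deriv
  have hhD : DifferentiableOn ℂ h unitDisk := hhA.differentiableOn
  have hhD' : DifferentiableOn ℂ (deriv h) unitDisk := hhA.deriv.differentiableOn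
  set β : ℕ → ℂ := fun n => iteratedDeriv n h 0 / (n.factorial : ℂ) with hβ
  have hβ0 : β 0 = 1 := by simp [hβ, hf1]
  have hfac : ∀ n : ℕ, (n.factorial : ℂ) ≠ 0 := fun n => by exact_mod_cast n.factorial_ne_zero
  have hβf : ∀ n : ℕ, ((n : ℂ) + 1) * diskCoeff (n + 1) f = β n := by
    intro n
    have h1 : ((n : ℂ) + 1) ≠ 0 := by exact_mod_cast n.succ_ne_zero
    have h2 := hfac n
    rw [diskCoeff_apply, iteratedDeriv_succ', Nat.factorial_succ, hβ]
    push_cast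
    field_simp
    rfl
  have hβS : ∀ z : ℂ, ‖z‖ < 1 → HasSum (fun n => β n * z ^ n) (h z) :=
    fun z hz => hasSum_taylor_unitDisk hhD hz
  have hβ' : ∀ z : ℂ, ‖z‖ < 1 → HasSum (fun n : ℕ => n * β n * z ^ n) (z * deriv h z) := by
    intro z hz
    have h1 := (hasSum_taylor_unitDisk hhD' hz).mul_left z
    rw [← hasSum_nat_add_iff' 1]
    simp only [Finset.range_one, Finset.sum_singleton, Nat.cast_zero, zero_mul, sub_zero]
    refine h1.congr_fun fun n => ?_
    have h2 := hfac n
    have h3 : ((n : ℂ) + 1) ≠ 0 := by exact_mod_cast n.succ_ne_zero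
    simp only [hβ]
    rw [iteratedDeriv_succ', Nat.factorial_succ]
    push_cast
    field_simp
    ring
  -- Division by `3` turns `Re (z h' / h) > -3/2` into `Re s > 1/2`, the normalization of Herglotz'
  -- theorem.
  set s : ℂ → ℂ := fun z => 1 + z * deriv h z / (3 * h z) with hs
  have hsD : DifferentiableOn ℂ s unitDisk := by
    refine (differentiableOn_const _).add (DifferentiableOn.div
      (differentiableOn_id.mul hhD') (hhD.const_mul 3) fun z hz => ?_)
    exact mul_ne_zero three_ne_zero (hfG z hz).1
  set σ : ℕ → ℂ := fun n => iteratedDeriv n s 0 / (n.factorial : ℂ) with hσ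
  have hσS : ∀ z : ℂ, ‖z‖ < 1 → HasSum (fun n => σ n * z ^ n) (s z) :=
    fun z hz => hasSum_taylor_unitDisk hsD hz
  obtain ⟨μ, hμ⟩ := exists_circleMoment_eq_of_half_le_re (c := σ) (q := s)
    (by simp [hσ, hs]) hσS (fun z hz => by
      have h1 := (hfG z (mem_unitDisk.2 hz)).2
      have h2 : s z = 1 + ((1 / 3 : ℝ) : ℂ) * (z * deriv h z / h z) := by
        simp only [hs]; push_cast; rw [div_mul_eq_div_div_swap]; ring
      rw [h2]
      simp only [add_re, one_re, re_ofReal_mul] at h1 ⊢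
      linarith)
  have hrec : ∀ n : ℕ, (1 + (n : ℂ) / 3) * β n =
      ∑ k ∈ Finset.range (n + 1), β k * σ (n - k) := by
    have h1 : (fun n : ℕ => (1 + (n : ℂ) / 3) * β n) =
        fun n => ∑ k ∈ Finset.range (n + 1), β k * σ (n - k) := by
      refine coeff_unique_of_hasSum (g := fun z => h z + z * deriv h z / 3) (fun z hz => ?_)
        fun z hz => ?_
      · exact ((hβS z hz).add ((hβ' z hz).div_const 3)).congr_fun fun n => by ring
      · have h2 : h z + z * deriv h z / 3 = h z * s z := by
          have := (hfG z (mem_unitDisk.2 hz)).1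
          simp only [hs]
          field_simp
        have h3 := (hβS z hz).summable.norm
        have h4 := (hσS z hz).summable.norm
        have h5 : ∀ n, ∑ k ∈ Finset.range (n + 1), β k * z ^ k * (σ (n - k) * z ^ (n - k)) =
            (∑ k ∈ Finset.range (n + 1), β k * σ (n - k)) * z ^ n := by
          intro n
          rw [Finset.sum_mul]
          refine Finset.sum_congr rfl fun k hk => ?_
          rw [← pow_mul_pow_sub z (Nat.lt_succ_iff.1 (Finset.mem_range.1 hk))]
          ring
        rw [h2, ← (hβS z hz).tsum_eq, ← (hσS z hz).tsum_eq,
          tsum_mul_tsum_eq_tsum_sum_range_of_summable_norm h3 h4]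
        simp_rw [h5]
        have h6 := summable_norm_sum_mul_range_of_summable_norm h3 h4
        simp_rw [h5] at h6
        exact h6.of_norm.hasSum
    exact fun n => congrFun h1 n
  have hch : ∀ n : ℕ, (((n + 2).choose 2 : ℕ) : ℂ) ≠ 0 := fun n => by
    exact_mod_cast (Nat.choose_pos (Nat.le_add_left 2 n)).ne'
  have hch3 : ∀ n : ℕ, (((n + 3).choose 3 : ℕ) : ℂ) =
      (1 + (n : ℂ) / 3) * (((n + 2).choose 2 : ℕ) : ℂ) := by
    intro n
    have h1 := Nat.add_one_mul_choose_eq (n + 2) 2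
    have h2 : ((n : ℂ) + 2 + 1) * (((n + 2).choose 2 : ℕ) : ℂ) =
        (((n + 3).choose 3 : ℕ) : ℂ) * (2 + 1) := by exact_mod_cast h1
    linear_combination -(1 / 3) * h2
  -- `C(n+2, 2)` are the coefficients of `(1 - z)⁻³`, so `c` is the candidate moment sequence for
  -- `f' = ∫ (1 - x z)⁻³ dν`.
  set c : ℕ → ℂ := fun n => β n / (((n + 2).choose 2 : ℕ) : ℂ) with hc
  have hcrec : ∀ n, (((n + 3).choose 3 : ℕ) : ℂ) * c n = ∑ k ∈ Finset.range (n + 1),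
      (((k + 2).choose 2 : ℕ) : ℂ) * c k * circleMoment μ (n - k) := by
    intro n
    have h1 : ∀ k, (((k + 2).choose 2 : ℕ) : ℂ) * c k = β k := fun k =>
      mul_div_cancel₀ _ (hch k)
    simp_rw [hch3, mul_assoc (1 + (n : ℂ) / 3), h1, hrec, hμ]
  obtain ⟨ν, hν⟩ := exists_circleMoment_eq_of_recursion μ (c := c) (by simp [hc, hβ0]) hcrec
  refine ⟨μ, ν, ⟨?_, fun n => ?_⟩, by rw [hν]; exact hcrec⟩
  · simp [diskCoeff_apply, hf0]
  · have h1 : ((n : ℂ) + 1) ≠ 0 := by exact_mod_cast n.succ_ne_zero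
    have h2 : (((n + 2).choose 2 : ℕ) : ℂ) = ((n : ℂ) + 1) * ((n : ℂ) + 2) / 2 := by
      rw [Nat.cast_choose_two]; push_cast; ring
    have h3 : ((n : ℂ) + 2) ≠ 0 := by exact_mod_cast (n + 1).succ_ne_zero
    rw [hν, hc]
    simp only [h2, ← hβf n]
    field_simp

theorem classG_subset_momentClass : classG ⊆ momentClass := fun _ hf => by
  obtain ⟨_, ν, hν, _⟩ := exists_isRepresentedBy_of_mem_classG hf
  exact ⟨ν, hν⟩

theorem diskExt_extremalFun {x : ℂ} (hx : ‖x‖ = 1) {z : ℂ} (hz : z ∈ unitDisk) :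
    diskExt (extremalFun x hx) z = (z - x / 2 * z ^ 2) / (1 - x * z) ^ 2 :=
  diskExt_of_mem _ hz

theorem diskCoeff_extremalFun {x : ℂ} (hx : ‖x‖ = 1) :
    diskCoeff 0 (extremalFun x hx) = 0 ∧
      ∀ n : ℕ, diskCoeff (n + 1) (extremalFun x hx) = ((n : ℂ) + 2) / 2 * x ^ n := by
  have key := diskCoeff_eq_of_hasSum (f := extremalFun x hx)
    (a := fun n => if n = 0 then 0 else ((n : ℂ) + 1) / 2 * x ^ (n - 1)) (fun z hz => by
      rw [diskExt_extremalFun hx (mem_unitDisk.2 hz), ← hasSum_nat_add_iff' 1]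
      have hxz : ‖x * z‖ < 1 := by rwa [norm_mul, hx, one_mul]
      have h1 := (hasSum_choose_mul_geometric_of_norm_lt_one 1 hxz).mul_left (z / 2)
      have h0 := (hasSum_geometric_of_norm_lt_one hxz).mul_left (z / 2)
      have hne := one_sub_mul_ne_zero_of_mem_unitDisk hx (mem_unitDisk.2 hz)
      have h2 : (z - x / 2 * z ^ 2) / (1 - x * z) ^ 2 =
          z / 2 * (1 / (1 - x * z) ^ (1 + 1)) + z / 2 * (1 - x * z)⁻¹ := by
        have h3 : ∀ t : ℂ, t ≠ 0 →
            z / 2 * (1 / t ^ (1 + 1)) + z / 2 * t⁻¹ = z * (1 + t) / 2 / t ^ 2 := by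
          intro t ht
          field_simp
          ring
        rw [h3 _ hne]
        congr 1
        ring
      simp only [Finset.range_one, Finset.sum_singleton, if_true, zero_mul, sub_zero]
      rw [h2]
      refine (h1.add h0).congr_fun fun n => ?_
      rw [if_neg n.succ_ne_zero, Nat.add_sub_cancel, Nat.choose_one_right]
      push_cast
      ring)
  refine ⟨by simp [key], fun n => ?_⟩
  rw [key, if_neg n.succ_ne_zero, Nat.add_sub_cancel]
  push_cast
  ring

theorem deriv_diskExt_extremalFun {x : ℂ} (hx : ‖x‖ = 1) :
    Set.EqOn (deriv (diskExt (extremalFun x hx))) (fun z => ((1 - x * z) ^ 3)⁻¹) unitDisk := by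
  have h1 : Set.EqOn (diskExt (extremalFun x hx))
      (fun z => (z - x / 2 * z ^ 2) / (1 - x * z) ^ 2) unitDisk :=
    fun z hz => diskExt_extremalFun hx hz
  intro z hz
  rw [h1.deriv Metric.isOpen_ball hz]
  have hne := one_sub_mul_ne_zero_of_mem_unitDisk hx hz
  have hd : HasDerivAt (fun z => 1 - x * z) (-x) z := by
    simpa using ((hasDerivAt_id z).const_mul x).const_sub 1
  have hn : HasDerivAt (fun z => z - x / 2 * z ^ 2) (1 - x / 2 * (2 * z)) z := by
    simpa using (hasDerivAt_id z).fun_sub ((hasDerivAt_pow 2 z).const_mul (x / 2))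
  rw [(hn.fun_div (hd.fun_pow 2) (pow_ne_zero 2 hne)).deriv]
  field_simp
  ring

theorem extremalFun_mem_classG {x : ℂ} (hx : ‖x‖ = 1) : extremalFun x hx ∈ classG := by
  have h1 := deriv_diskExt_extremalFun hx
  refine ⟨⟨?_, ?_⟩, fun z hz => ?_⟩
  · rw [diskExt_extremalFun hx (by simp)]; simp
  · rw [h1 (by simp)]; simp
  · have hne := one_sub_mul_ne_zero_of_mem_unitDisk hx hz
    have h2 : deriv (deriv (diskExt (extremalFun x hx))) z = 3 * x * ((1 - x * z) ^ 4)⁻¹ := by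
      rw [h1.deriv Metric.isOpen_ball hz]
      have hd : HasDerivAt (fun z => 1 - x * z) (-x) z := by
        simpa using ((hasDerivAt_id z).const_mul x).const_sub 1
      rw [((hd.fun_pow 3).fun_inv (pow_ne_zero 3 hne)).deriv]
      field_simp
      ring
    rw [h2, h1 hz]
    refine ⟨inv_ne_zero (pow_ne_zero 3 hne), ?_⟩
    have h3 : 1 + z * (3 * x * ((1 - x * z) ^ 4)⁻¹) / ((1 - x * z) ^ 3)⁻¹ =
        ((3 : ℝ) : ℂ) * (1 - x * z)⁻¹ - ((2 : ℝ) : ℂ) := by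
      have h5 : z * x = 1 - (1 - x * z) := by ring
      push_cast
      rw [show z * (3 * x * ((1 - x * z) ^ 4)⁻¹) = 3 * (z * x) * ((1 - x * z) ^ 4)⁻¹ by ring, h5]
      field_simp
      ring
    have hxz : ‖x * z‖ < 1 := by rw [norm_mul, hx, one_mul]; exact mem_unitDisk.1 hz
    have h4 := half_lt_re_inv_one_sub hxz
    rw [h3, sub_re, re_ofReal_mul, ofReal_re]
    linarith

/-! ### Continuous linear functionals on `𝓗` -/

/-- A compact-open neighbourhood of `0` constrains a function only on a compact set, which lies in a
disk of radius `r < 1`; scaling then turns continuity at `0` into a seminorm bound. -/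
theorem exists_norm_apply_le (J : AnalyticDisk →L[ℂ] ℂ) :
    ∃ r K : ℝ, 0 < r ∧ r < 1 ∧ 0 ≤ K ∧ ∀ (f : AnalyticDisk) (M : ℝ), 0 < M →
      (∀ z : ℂ, ‖z‖ ≤ r → ‖diskExt f z‖ ≤ M) → ‖J f‖ ≤ K * M := by
  have h1 : J ⁻¹' Metric.ball 0 1 ∈ 𝓝 (0 : AnalyticDisk) :=
    J.continuous.continuousAt.preimage_mem_nhds (by simpa using Metric.ball_mem_nhds (0 : ℂ) one_pos)
  rw [nhds_induced] at h1
  obtain ⟨t, ht, htJ⟩ := h1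
  have hb := Filter.HasBasis.nhds_continuousMapConst (X := unitDisk) (c := (0 : ℂ))
    Metric.nhds_basis_ball
  obtain ⟨⟨S, ε⟩, ⟨hS, hε⟩, hSt⟩ := hb.mem_iff.1 ht
  simp only at hS hε hSt
  have hS' : IsCompact ((↑) '' S : Set ℂ) := hS.image continuous_subtype_val
  obtain ⟨r, hr, hrS⟩ := exists_pos_lt_subset_ball one_pos hS'.isClosed
    (show ((↑) '' S : Set ℂ) ⊆ Metric.ball 0 1 by rintro _ ⟨z, _, rfl⟩; exact z.2)
  refine ⟨r, 2 / ε, hr.1, hr.2, by positivity, fun f M hM hf => ?_⟩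
  have h2 : (((ε / (2 * M) : ℝ) : ℂ) • f : AnalyticDisk) ∈ J ⁻¹' Metric.ball 0 1 := by
    refine htJ (hSt fun z hz => ?_)
    have h3 : ‖diskExt f (z : ℂ)‖ ≤ M :=
      hf z (mem_ball_zero_iff.1 (hrS ⟨z, hz, rfl⟩)).le
    rw [diskExt_of_mem _ z.2] at h3
    rw [mem_ball_zero_iff, Submodule.coe_smul, ContinuousMap.smul_apply, norm_smul, norm_real,
      Real.norm_of_nonneg (by positivity)]
    calc ε / (2 * M) * ‖(f : C(unitDisk, ℂ)) z‖ ≤ ε / (2 * M) * M := by gcongr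
      _ = ε / 2 := by field_simp
      _ < ε := by linarith
  rw [Set.mem_preimage, mem_ball_zero_iff, map_smul, norm_smul, norm_real,
    Real.norm_of_nonneg (by positivity), div_mul_eq_mul_div, div_lt_one (by positivity)] at h2
  rw [div_mul_eq_mul_div, le_div_iff₀ hε]
  linarith

/-- The monomial `zⁿ` as an element of `𝓗`. -/
noncomputable def diskMonomial (n : ℕ) : AnalyticDisk :=
  ⟨⟨fun z => (z : ℂ) ^ n, by fun_prop⟩, by
    have h : AnalyticOnNhd ℂ (fun z : ℂ => z ^ n) unitDisk := fun z _ => by fun_prop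
    refine h.congr Metric.isOpen_ball fun z hz => ?_
    rw [diskExt_of_mem _ hz]
    rfl⟩

theorem diskExt_diskMonomial (n : ℕ) {z : ℂ} (hz : z ∈ unitDisk) :
    diskExt (diskMonomial n) z = z ^ n :=
  diskExt_of_mem _ hz

theorem diskExt_sub_sum_diskMonomial (f : AnalyticDisk) (a : ℕ → ℂ) (N : ℕ) {z : ℂ}
    (hz : z ∈ unitDisk) :
    diskExt (f - ∑ n ∈ Finset.range N, a n • diskMonomial n : AnalyticDisk) z =
      diskExt f z - ∑ n ∈ Finset.range N, a n * z ^ n := by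
  let ev : AnalyticDisk →ₗ[ℂ] ℂ :=
    { toFun := fun g => diskExt g z
      map_add' := fun g h => by rw [Submodule.coe_add, diskExt_add]; rfl
      map_smul' := fun c g => by rw [Submodule.coe_smul, diskExt_smul]; rfl }
  have h : ev (f - ∑ n ∈ Finset.range N, a n • diskMonomial n) =
      ev f - ∑ n ∈ Finset.range N, a n * z ^ n := by
    rw [eq_sub_iff_add_eq, ← sub_add_cancel f (∑ n ∈ Finset.range N, a n • diskMonomial n),
      map_add, add_sub_cancel_right, map_sum]
    congr 1
    refine Finset.sum_congr rfl fun n _ => ?_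
    rw [map_smul, smul_eq_mul]
    congr 1
    exact (diskExt_diskMonomial n hz).symm
  exact h

/-- A continuous functional is given by a sequence of geometric decay in terms of the Taylor
coefficients. -/
theorem exists_hasSum_apply (J : AnalyticDisk →L[ℂ] ℂ) :
    ∃ r K : ℝ, 0 < r ∧ r < 1 ∧ 0 ≤ K ∧ (∀ n, ‖J (diskMonomial n)‖ ≤ K * r ^ n) ∧
      ∀ f, HasSum (fun n => diskCoeff n f * J (diskMonomial n)) (J f) := by
  obtain ⟨r, K, hr0, hr1, hK, hJ⟩ := exists_norm_apply_le J
  have hmono : ∀ n, ‖J (diskMonomial n)‖ ≤ K * r ^ n := by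
    intro n
    refine hJ _ _ (pow_pos hr0 n) fun z hz => ?_
    rw [diskExt_diskMonomial n (mem_unitDisk.2 (hz.trans_lt hr1)), norm_pow]
    exact pow_le_pow_left₀ (norm_nonneg z) hz n
  refine ⟨r, K, hr0, hr1, hK, hmono, fun f => ?_⟩
  have hs : Summable fun n => ‖diskCoeff n f‖ * r ^ n :=
    summable_norm_mul_pow (fun _ hz => hasSum_diskCoeff f hz) hr0.le hr1
  have hsJ : Summable fun n => diskCoeff n f * J (diskMonomial n) := by
    refine Summable.of_norm_bounded (hs.mul_left K) fun n => ?_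
    rw [norm_mul]
    calc _ ≤ ‖diskCoeff n f‖ * (K * r ^ n) := by gcongr; exact hmono n
      _ = _ := by ring
  rw [hsJ.hasSum_iff_tendsto_nat, tendsto_iff_norm_sub_tendsto_zero]
  set τ : ℕ → ℝ := fun N => ∑' n, ‖diskCoeff (n + N) f‖ * r ^ (n + N) with hτ
  have hτ0 : Tendsto τ atTop (𝓝 0) := tendsto_sum_nat_add fun n => ‖diskCoeff n f‖ * r ^ n
  -- The tail `τ N` may vanish, while `exists_norm_apply_le` wants a positive bound; the summand `1
  -- / (N + 1)` supplies it.
  have hlim : Tendsto (fun N : ℕ => K * (τ N + 1 / ((N : ℝ) + 1))) atTop (𝓝 0) := by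
    simpa using (hτ0.add tendsto_one_div_add_atTop_nhds_zero_nat).const_mul K
  refine squeeze_zero (fun _ => norm_nonneg _) (fun N => ?_) hlim
  have h1 : J (f - ∑ n ∈ Finset.range N, diskCoeff n f • diskMonomial n) =
      J f - ∑ n ∈ Finset.range N, diskCoeff n f * J (diskMonomial n) := by
    have h2 : J (∑ n ∈ Finset.range N, diskCoeff n f • diskMonomial n) =
        ∑ n ∈ Finset.range N, diskCoeff n f * J (diskMonomial n) := by
      rw [map_sum]
      simp
    rw [eq_sub_iff_add_eq, ← h2, ← map_add]
    exact congrArg J (sub_add_cancel f _)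
  rw [norm_sub_rev, ← h1]
  have hτN : 0 ≤ τ N := tsum_nonneg fun n => by positivity
  refine hJ _ _ (by positivity) fun z hz => ?_
  have hz1 : ‖z‖ < 1 := hz.trans_lt hr1
  rw [diskExt_sub_sum_diskMonomial _ _ _ (mem_unitDisk.2 hz1)]
  have h2 := (hasSum_nat_add_iff' N).2 (hasSum_diskCoeff f hz1)
  have h3 : ‖diskExt f z - ∑ n ∈ Finset.range N, diskCoeff n f * z ^ n‖ ≤ τ N := by
    rw [← h2.tsum_eq]
    refine tsum_of_norm_bounded ((summable_nat_add_iff N).2 hs).hasSum fun n => ?_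
    rw [norm_mul, norm_pow]
    gcongr
  have h4 : 0 ≤ 1 / ((N : ℝ) + 1) := by positivity
  linarith

/-- On represented functions, a functional is integration of a function that is analytic
across the unit circle. -/
theorem exists_apply_eq_integral (J : AnalyticDisk →L[ℂ] ℂ) :
    ∃ (F : ℂ → ℂ) (R : ℝ), 1 < R ∧ DifferentiableOn ℂ F (Metric.ball 0 R) ∧
      (∀ x hx, J (extremalFun x hx) = F x) ∧
      ∀ f ν, IsRepresentedBy f ν →
        J f = ∫ x : unitSphere, F x ∂(ν : Measure unitSphere) := by
  obtain ⟨r, K, hr0, hr1, hK, hmono, hJ⟩ := exists_hasSum_apply J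
  obtain ⟨s, hrs, hs1⟩ := exists_between hr1
  have hs0 : 0 < s := hr0.trans hrs
  -- The Taylor coefficients of `F`. The decay `K r ^ (n + 1)` of `J` on monomials gives convergence
  -- on the disk of radius `s / r > 1`.
  set e : ℕ → ℂ := fun n => ((n : ℂ) + 2) / 2 * J (diskMonomial (n + 1)) with he
  set B : ℕ → ℝ := fun n => K * r * (((n + 1).choose 1 : ℕ) * s ^ n) +
    K * r * s ^ n with hB
  have hBs : Summable B := by
    refine Summable.add (Summable.mul_left _ ?_)
      ((summable_geometric_of_lt_one hs0.le hs1).mul_left _)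
    exact (hasSum_choose_mul_geometric_of_norm_lt_one (𝕜 := ℝ) 1
      (r := s) (by simpa [abs_of_pos hs0] using hs1)).summable
  have hbound : ∀ n (w : ℂ), w ∈ Metric.ball (0 : ℂ) (s / r) → ‖e n * w ^ n‖ ≤ B n := by
    intro n w hw
    have hw' : ‖w‖ ≤ s / r := (mem_ball_zero_iff.1 hw).le
    have h1 : ‖((n : ℂ) + 2) / 2‖ ≤ (n : ℝ) + 2 := by
      rw [norm_div, show (n : ℂ) + 2 = ((n + 2 : ℕ) : ℂ) by push_cast; ring, norm_natCast]
      push_cast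
      simp only [RCLike.norm_ofNat]
      linarith [Nat.cast_nonneg (α := ℝ) n]
    rw [he, norm_mul, norm_mul, norm_pow]
    calc _ ≤ ((n : ℝ) + 2) * (K * r ^ (n + 1)) * (s / r) ^ n := by
          gcongr
          exact hmono _
      _ = B n := by
          rw [hB, div_pow]
          simp only [Nat.choose_one_right]
          push_cast
          field_simp
          ring
  have hR : 1 < s / r := (one_lt_div hr0).2 hrs
  have hsph : ∀ x : unitSphere, (x : ℂ) ∈ Metric.ball (0 : ℂ) (s / r) := fun x => by
    rw [mem_ball_zero_iff, norm_coe_unitSphere]; exact hR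
  have hsumF : ∀ w ∈ Metric.ball (0 : ℂ) (s / r),
      HasSum (fun n => e n * w ^ n) (∑' n, e n * w ^ n) := fun w hw =>
    (Summable.of_norm_bounded hBs fun n => hbound n w hw).hasSum
  have hshift : ∀ f, diskCoeff 0 f = 0 →
      HasSum (fun n => diskCoeff (n + 1) f * J (diskMonomial (n + 1))) (J f) := by
    intro f hf
    have := (hasSum_nat_add_iff' 1).2 (hJ f)
    simpa [hf] using this
  refine ⟨fun w => ∑' n, e n * w ^ n, s / r, hR, ?_, fun x hx => ?_, fun f ν hf => ?_⟩
  · exact differentiableOn_tsum_of_summable_norm hBs (fun n => by fun_prop) Metric.isOpen_ball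
      hbound
  · obtain ⟨h0, h1⟩ := diskCoeff_extremalFun hx
    refine (hshift _ h0).unique ((hsumF x ?_).congr_fun fun n => ?_)
    · exact hsph ⟨x, by simpa using hx⟩
    · rw [h1, he]
      ring
  · refine (hshift f hf.1).unique ?_
    have h := hasSum_integral_of_norm_le (P := (ν : Measure unitSphere))
      (F := fun n x => e n * (x : ℂ) ^ n) (fun n => by fun_prop) hBs
      (fun n x => hbound n x (hsph x)) (fun x => hsumF x (hsph x))
    refine h.congr_fun fun n => ?_
    rw [hf.2, integral_const_mul, he]
    simp only [circleMoment]
    ring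

theorem continuous_comp_coe_unitSphere {F : ℂ → ℂ} {R : ℝ} (hR : 1 < R)
    (hF : DifferentiableOn ℂ F (Metric.ball 0 R)) : Continuous fun x : unitSphere => F x :=
  hF.continuousOn.comp_continuous continuous_subtype_val fun x => by
    rw [mem_ball_zero_iff, norm_coe_unitSphere]; exact hR

theorem integrable_comp_coe_unitSphere {F : ℂ → ℂ} {R : ℝ} (hR : 1 < R)
    (hF : DifferentiableOn ℂ F (Metric.ball 0 R)) (ν : Measure unitSphere) [IsFiniteMeasure ν] :
    Integrable (fun x : unitSphere => F x) ν :=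
  (continuous_comp_coe_unitSphere hR hF).integrable_of_hasCompactSupport
    (HasCompactSupport.of_compactSpace _)

/-- `t ↦ Re F (exp (i t))` is real-analytic, and infinitely many arguments in `[-π, π]` accumulate,
so the identity theorem applies. -/
theorem finite_or_forall_re_eq {F : ℂ → ℂ} {R : ℝ} (hR : 1 < R)
    (hF : DifferentiableOn ℂ F (Metric.ball 0 R)) (M : ℝ) :
    {x : unitSphere | (F x).re = M}.Finite ∨ ∀ x : unitSphere, (F x).re = M := by
  rw [or_iff_not_imp_left]
  intro hinf
  have hinf : {x : unitSphere | (F x).re = M}.Infinite := hinf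
  have harg : ∀ x : unitSphere, exp (arg (x : ℂ) * I) = x := fun x => by
    have := norm_mul_exp_arg_mul_I (x : ℂ)
    rwa [norm_coe_unitSphere, ofReal_one, one_mul] at this
  set φ : ℝ → ℝ := fun t => (F (exp (t * I))).re with hφ
  have hφA : AnalyticOnNhd ℝ φ Set.univ := by
    intro t _
    have h1 : AnalyticAt ℂ F (exp (t * I)) := by
      refine hF.analyticAt (Metric.isOpen_ball.mem_nhds ?_)
      rw [mem_ball_zero_iff, norm_exp_ofReal_mul_I]; exact hR
    have h2 : AnalyticAt ℝ (fun t : ℝ => exp (t * I)) t := by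
      have h3 : AnalyticAt ℝ (fun t : ℝ => (t : ℂ)) t := ofRealCLM.analyticAt t
      have h5 : AnalyticAt ℝ (fun t : ℝ => (t : ℂ) * I) t := h3.mul analyticAt_const
      exact AnalyticAt.comp (g := exp) (f := fun t : ℝ => (t : ℂ) * I)
        analyticAt_cexp.restrictScalars h5
    have h4 : AnalyticAt ℝ (fun t : ℝ => F (exp (t * I))) t :=
      AnalyticAt.comp (g := F) (f := fun t : ℝ => exp (t * I)) h1.restrictScalars h2
    exact (reCLM.analyticAt _).comp h4
  have hS : ((fun x : unitSphere => arg (x : ℂ)) '' {x : unitSphere | (F x).re = M}).Infinite := by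
    refine hinf.image fun x _ y _ hxy => Subtype.ext ?_
    rw [← harg x, show arg (x : ℂ) = arg (y : ℂ) from hxy, harg y]
  obtain ⟨t₀, -, ht₀⟩ := hS.exists_accPt_of_subset_isCompact
    (isCompact_Icc (a := -Real.pi) (b := Real.pi)) (by
      rintro _ ⟨x, _, rfl⟩
      exact ⟨(neg_pi_lt_arg _).le, arg_le_pi _⟩)
  have hfreq : ∃ᶠ t in 𝓝[≠] t₀, φ t = M := by
    refine (accPt_iff_frequently_nhdsNE.1 ht₀).mono ?_
    rintro _ ⟨x, hx, rfl⟩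
    simp only [hφ]
    rw [harg]
    exact hx
  have heq := hφA.eqOn_of_preconnected_of_frequently_eq (g := fun _ => M) analyticOnNhd_const
    isPreconnected_univ (Set.mem_univ t₀) hfreq
  intro x
  have := heq (Set.mem_univ (arg (x : ℂ)))
  simp only [hφ] at this
  rwa [harg] at this

/-! ### The closed convex hull of `𝓖` -/

instance : LocallyConvexSpace ℝ AnalyticDisk :=
  inferInstanceAs (LocallyConvexSpace ℝ (AnalyticDisk.restrictScalars ℝ))

theorem closedConvexHull_classG : closedConvexHull ℝ classG = momentClass := by
  refine subset_antisymm (closedConvexHull_min classG_subset_momentClass convex_momentClass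
    isClosed_momentClass) ?_
  rintro f ⟨ν, hν⟩
  by_contra hf
  obtain ⟨J, u, hJu, huf⟩ := RCLike.geometric_hahn_banach_closed_point (𝕜 := ℂ)
    convex_closedConvexHull isClosed_closedConvexHull hf
  obtain ⟨F, R, hR, hF, hFx, hFint⟩ := exists_apply_eq_integral J
  have hI := integrable_comp_coe_unitSphere hR hF (ν : Measure unitSphere)
  -- `Re J f` is an average of the values `Re J (extremalFun x)`, all below `u`, so no functional
  -- separates `f` from the hull.
  have h1 : (J f).re ≤ u := by
    rw [hFint f ν hν]
    calc (∫ x : unitSphere, F x ∂(ν : Measure unitSphere)).re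
        = ∫ x : unitSphere, (F x).re ∂(ν : Measure unitSphere) := (integral_re hI).symm
      _ ≤ ∫ _ : unitSphere, u ∂(ν : Measure unitSphere) := by
          refine integral_mono hI.re (integrable_const u) fun x => ?_
          have h2 := hJu (extremalFun x (norm_coe_unitSphere x))
            (subset_closedConvexHull (extremalFun_mem_classG (norm_coe_unitSphere x)))
          rw [hFx] at h2
          exact h2.le
      _ = u := by simp
  exact absurd huf (not_lt.2 h1)

/-! ### Extreme points and support points -/

theorem IsRepresentedBy.eq_extremalFun {f : AnalyticDisk} {ν : ProbabilityMeasure unitSphere}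
    (hf : IsRepresentedBy f ν) {x : ℂ} (hx : ‖x‖ = 1) (h : ∀ n, circleMoment ν n = x ^ n) :
    f = extremalFun x hx := by
  obtain ⟨h0, h1⟩ := diskCoeff_extremalFun hx
  refine AnalyticDisk.ext_diskCoeff fun n => ?_
  cases n with
  | zero => rw [hf.1, h0]
  | succ n => rw [hf.2, h1, h]

/-- Equality case of `Re (x̄ m₁) ≤ 1`: on the circle `|y - x|² = 2 - 2 Re (x̄ y)`, whose integral
vanishes. -/
theorem ae_eq_of_re_conj_mul_circleMoment {ν : ProbabilityMeasure unitSphere} {x : ℂ}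
    (hx : ‖x‖ = 1) (h : ((starRingEnd ℂ) x * circleMoment ν 1).re = 1) :
    ∀ᵐ y : unitSphere ∂(ν : Measure unitSphere), (y : ℂ) = x := by
  have hsq : ∀ y : unitSphere, ‖(y : ℂ) - x‖ ^ 2 = 2 - 2 * ((starRingEnd ℂ) x * (y : ℂ) ^ 1).re := by
    intro y
    have hy := norm_coe_unitSphere y
    rw [← Complex.normSq_eq_norm_sq, Complex.normSq_sub, Complex.normSq_eq_norm_sq,
      Complex.normSq_eq_norm_sq, hx, hy, pow_one, mul_comm (y : ℂ)]
    norm_num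
  have hI : Integrable (fun y : unitSphere => (starRingEnd ℂ) x * (y : ℂ) ^ 1)
      (ν : Measure unitSphere) := (integrable_pow_unitSphere _ 1).const_mul _
  have hint : ∫ y : unitSphere, ‖(y : ℂ) - x‖ ^ 2 ∂(ν : Measure unitSphere) = 0 := by
    have h2 : ∫ y : unitSphere, ((starRingEnd ℂ) x * (y : ℂ) ^ 1).re ∂(ν : Measure unitSphere)
        = 1 := by
      refine Eq.trans ?_ h
      rw [circleMoment, ← integral_const_mul]
      exact integral_re hI
    have hI2 : Integrable (fun y : unitSphere => 2 * ((starRingEnd ℂ) x * (y : ℂ) ^ 1).re)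
        (ν : Measure unitSphere) := hI.re.const_mul 2
    simp_rw [hsq]
    rw [integral_sub (integrable_const _) hI2, integral_const_mul, h2]
    simp
  rw [integral_eq_zero_iff_of_nonneg (fun _ => by positivity)] at hint
  · filter_upwards [hint] with y hy
    rw [← sub_eq_zero, ← norm_eq_zero]
    exact pow_eq_zero_iff two_ne_zero |>.1 hy
  · exact Continuous.integrable_of_hasCompactSupport (by fun_prop)
      (HasCompactSupport.of_compactSpace _)

theorem re_conj_mul_circleMoment_le {x : ℂ} (hx : ‖x‖ = 1) (ν : ProbabilityMeasure unitSphere)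
    (n : ℕ) : ((starRingEnd ℂ) x * circleMoment ν n).re ≤ 1 := by
  refine (re_le_norm _).trans ?_
  rw [norm_mul, RCLike.norm_conj, hx, one_mul]
  exact norm_circleMoment_le ν n

theorem diskCoeff_two_extremalFun {x : ℂ} (hx : ‖x‖ = 1) :
    diskCoeff 2 (extremalFun x hx) = 3 / 2 * x := by
  have h := (diskCoeff_extremalFun hx).2 1
  norm_num at h
  rw [h]

theorem IsRepresentedBy.diskCoeff_two {f : AnalyticDisk} {ν : ProbabilityMeasure unitSphere}
    (hf : IsRepresentedBy f ν) : diskCoeff 2 f = 3 / 2 * circleMoment ν 1 := by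
  have h := hf.2 1
  norm_num at h
  rw [h]

theorem extremalFun_mem_extremePoints {x : ℂ} (hx : ‖x‖ = 1) :
    extremalFun x hx ∈ Set.extremePoints ℝ momentClass := by
  refine ⟨classG_subset_momentClass (extremalFun_mem_classG hx), ?_⟩
  rintro f ⟨ν, hν⟩ g ⟨ξ, hξ⟩ ⟨s, t, hs, ht, hst, hfg⟩
  have h1 : x = s * circleMoment ν 1 + t * circleMoment ξ 1 := by
    have h2 := congrArg (diskCoeff 2) hfg
    rw [map_add, ContinuousLinearMap.map_smul_of_tower, ContinuousLinearMap.map_smul_of_tower,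
      hν.diskCoeff_two, hξ.diskCoeff_two, diskCoeff_two_extremalFun, real_smul, real_smul] at h2
    linear_combination -(2 / 3) * h2
  have h3 : s * ((starRingEnd ℂ) x * circleMoment ν 1).re +
      t * ((starRingEnd ℂ) x * circleMoment ξ 1).re = 1 := by
    rw [← re_ofReal_mul, ← re_ofReal_mul, ← add_re]
    rw [show (s : ℂ) * ((starRingEnd ℂ) x * circleMoment ν 1) +
      t * ((starRingEnd ℂ) x * circleMoment ξ 1) =
      (s * circleMoment ν 1 + t * circleMoment ξ 1) * (starRingEnd ℂ) x by ring, ← h1,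
      Complex.mul_conj, Complex.normSq_eq_norm_sq, hx]
    simp
  have h4 : ((starRingEnd ℂ) x * circleMoment ν 1).re = 1 := by
    refine le_antisymm (re_conj_mul_circleMoment_le hx ν 1) ?_
    have h5 := re_conj_mul_circleMoment_le hx ξ 1
    nlinarith
  exact hν.eq_extremalFun hx
    (circleMoment_eq_pow_of_ae_eq (ae_eq_of_re_conj_mul_circleMoment hx h4))

theorem exists_circleMoment_cond (ν : ProbabilityMeasure unitSphere) {A : Set unitSphere}
    (hA : (ν : Measure unitSphere) A ≠ 0) :
    ∃ ξ, ∀ n, (ν : Measure unitSphere).real A * circleMoment ξ n =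
      ∫ x in A, (x : ℂ) ^ n ∂(ν : Measure unitSphere) := by
  have hp := ProbabilityTheory.cond_isProbabilityMeasure hA
  refine ⟨⟨_, hp⟩, fun n => ?_⟩
  have hA' : ((ν : Measure unitSphere).real A : ℂ) ≠ 0 := by
    rw [Ne, ofReal_eq_zero, measureReal_eq_zero_iff]
    exact hA
  unfold circleMoment
  rw [ProbabilityMeasure.coe_mk, ProbabilityTheory.cond, integral_smul_measure,
    ENNReal.toReal_inv, real_smul, ofReal_inv]
  exact mul_inv_cancel_left₀ hA' _

theorem exists_eq_extremalFun_of_mem_extremePoints {f : AnalyticDisk}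
    (hf : f ∈ Set.extremePoints ℝ momentClass) : ∃ x hx, f = extremalFun x hx := by
  obtain ⟨⟨ν, hν⟩, hext⟩ := hf
  set m : ℂ := circleMoment ν 1 with hm
  -- Conditioning `ν` on `A` and on its complement writes `f` as a convex combination. Extremality
  -- makes both pieces equal to `f`, so the mean of `x` over every `A` of positive mass is `m`, and
  -- `x = m` almost everywhere.
  have hset : ∀ A : Set unitSphere, MeasurableSet A →
      ∫ x in A, (x : ℂ) ^ 1 ∂(ν : Measure unitSphere) =
        ∫ _ in A, m ∂(ν : Measure unitSphere) := by
    intro A hA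
    have hsplit : ∀ n, ∫ x in A, (x : ℂ) ^ n ∂(ν : Measure unitSphere) +
        ∫ x in Aᶜ, (x : ℂ) ^ n ∂(ν : Measure unitSphere) = circleMoment ν n := fun n =>
      integral_add_compl hA (integrable_pow_unitSphere _ n)
    rw [setIntegral_const, real_smul]
    by_cases h0 : (ν : Measure unitSphere) A = 0
    · rw [setIntegral_measure_zero _ h0, measureReal_def, h0]
      simp
    have h01 : (ν : Measure unitSphere).real A + (ν : Measure unitSphere).real Aᶜ = 1 :=
      probReal_add_probReal_compl hA
    by_cases h1 : (ν : Measure unitSphere) Aᶜ = 0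
    · have h2 := hsplit 1
      rw [setIntegral_measure_zero _ h1, add_zero] at h2
      rw [measureReal_def (s := Aᶜ), h1, ENNReal.toReal_zero, add_zero] at h01
      rw [h2, h01, ofReal_one, one_mul]
    obtain ⟨ξ, hξ⟩ := exists_circleMoment_cond ν h0
    obtain ⟨η, hη⟩ := exists_circleMoment_cond ν h1
    obtain ⟨g, hg⟩ := exists_isRepresentedBy ξ
    obtain ⟨h, hh⟩ := exists_isRepresentedBy η
    have hpos : ∀ B : Set unitSphere, (ν : Measure unitSphere) B ≠ 0 →
        0 < (ν : Measure unitSphere).real B := fun B hB =>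
      ENNReal.toReal_pos hB (measure_ne_top _ _)
    have hgf : g = f := by
      refine hext ⟨ξ, hg⟩ ⟨η, hh⟩ ⟨_, _, hpos A h0, hpos Aᶜ h1, h01, ?_⟩
      refine AnalyticDisk.ext_diskCoeff fun n => ?_
      rw [map_add, ContinuousLinearMap.map_smul_of_tower, ContinuousLinearMap.map_smul_of_tower,
        real_smul, real_smul]
      cases n with
      | zero => rw [hg.1, hh.1, hν.1]; simp
      | succ n =>
        rw [hg.2, hh.2, hν.2, ← hsplit n, ← hξ, ← hη]
        ring
    have h2 : circleMoment ξ 1 = m := by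
      have h3 := hg.diskCoeff_two
      rw [hgf, hν.diskCoeff_two] at h3
      linear_combination -(2 / 3) * h3
    rw [← hξ 1, h2]
  have hae : ∀ᵐ x : unitSphere ∂(ν : Measure unitSphere), (x : ℂ) = m := by
    have h := Integrable.ae_eq_of_forall_setIntegral_eq
      (fun x : unitSphere => (x : ℂ) ^ 1) (fun _ => m)
      (integrable_pow_unitSphere (ν : Measure unitSphere) 1) (integrable_const m)
      fun A hA _ => hset A hA
    filter_upwards [h] with x hx
    simpa using hx
  obtain ⟨x, hx⟩ := hae.exists
  have hm1 : ‖m‖ = 1 := by rw [← hx, norm_coe_unitSphere]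
  exact ⟨m, hm1, hν.eq_extremalFun hm1 (circleMoment_eq_pow_of_ae_eq hae)⟩

theorem extremePoints_closedConvexHull_classG :
    Set.extremePoints ℝ (closedConvexHull ℝ classG) =
      {f : AnalyticDisk | ∃ (x : ℂ) (hx : ‖x‖ = 1), f = extremalFun x hx} := by
  rw [closedConvexHull_classG]
  ext f
  constructor
  · exact exists_eq_extremalFun_of_mem_extremePoints
  · rintro ⟨x, hx, rfl⟩
    exact extremalFun_mem_extremePoints hx

theorem extremalFun_mem_supportPoints {x : ℂ} (hx : ‖x‖ = 1) :
    extremalFun x hx ∈ supportPoints classG := by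
  have hxx : (starRingEnd ℂ) x * x = 1 := by
    rw [mul_comm, Complex.mul_conj, Complex.normSq_eq_norm_sq, hx]; simp
  have hx' : ‖-x‖ = 1 := by rwa [norm_neg]
  have hJ : ∀ g, ((starRingEnd ℂ) x • diskCoeff 2) g = (starRingEnd ℂ) x * diskCoeff 2 g :=
    fun _ => rfl
  have hmax : (((starRingEnd ℂ) x • diskCoeff 2) (extremalFun x hx)).re = 3 / 2 := by
    rw [hJ, diskCoeff_two_extremalFun, mul_left_comm, hxx]
    norm_num
  -- The second coefficient, rotated by `x̄`, is maximized at `extremalFun x`; the parameter `-x`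
  -- gives the value `-3/2` and shows non-constancy.
  refine ⟨extremalFun_mem_classG hx, (starRingEnd ℂ) x • diskCoeff 2,
    ⟨_, extremalFun_mem_classG hx, _, extremalFun_mem_classG hx', ?_⟩, fun g hg => ?_⟩
  · rw [hmax, hJ, diskCoeff_two_extremalFun, mul_left_comm, mul_neg, hxx]
    norm_num
  · obtain ⟨ν, hν⟩ := classG_subset_momentClass hg
    have h1 := re_conj_mul_circleMoment_le hx ν 1
    change (((starRingEnd ℂ) x • diskCoeff 2) g).re ≤
      (((starRingEnd ℂ) x • diskCoeff 2) (extremalFun x hx)).re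
    rw [hmax, hJ, hν.diskCoeff_two, mul_left_comm,
      show (3 / 2 : ℂ) = ((3 / 2 : ℝ) : ℂ) by push_cast; rfl, re_ofReal_mul]
    linarith

theorem exists_eq_extremalFun_of_mem_supportPoints {f : AnalyticDisk}
    (hf : f ∈ supportPoints classG) : ∃ x hx, f = extremalFun x hx := by
  obtain ⟨hfG, J, ⟨g, hg, h, hh, hgh⟩, hmax⟩ := hf
  obtain ⟨μ, ν, hν, hrec⟩ := exists_isRepresentedBy_of_mem_classG hfG
  obtain ⟨F, R, hR, hF, hFx, hFint⟩ := exists_apply_eq_integral J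
  have hre : ∀ k ξ, IsRepresentedBy k ξ →
      (J k).re = ∫ x : unitSphere, (F x).re ∂(ξ : Measure unitSphere) := by
    intro k ξ hk
    rw [hFint k ξ hk]
    exact (integral_re (integrable_comp_coe_unitSphere hR hF _)).symm
  have hle : ∀ x : unitSphere, (F x).re ≤ (J f).re := fun x => by
    rw [← hFx x (norm_coe_unitSphere x)]
    exact hmax (extremalFun_mem_classG (norm_coe_unitSphere x))
  rcases finite_or_forall_re_eq hR hF (J f).re with hfin | hall
  · have hI' : Integrable (fun x : unitSphere => (F x).re) (ν : Measure unitSphere) :=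
      (integrable_comp_coe_unitSphere hR hF _).re
    have hI : Integrable (fun x : unitSphere => (J f).re - (F x).re) (ν : Measure unitSphere) :=
      (integrable_const _).sub hI'
    -- Since each `extremalFun x` lies in `𝓖`, the integrand is nonnegative, so `ν` is carried by
    -- the finite set where `Re F` is maximal and must have an atom.
    have hzero : ∫ x : unitSphere, ((J f).re - (F x).re) ∂(ν : Measure unitSphere) = 0 := by
      rw [integral_sub (integrable_const _) hI', ← hre f ν hν]
      simp
    rw [integral_eq_zero_iff_of_nonneg (fun x => sub_nonneg.2 (hle x)) hI] at hzero
    have hae : ∀ᵐ x : unitSphere ∂(ν : Measure unitSphere),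
        x ∈ {x : unitSphere | (F x).re = (J f).re} := by
      filter_upwards [hzero] with x hx
      exact (sub_eq_zero.1 hx).symm
    have hatom : ∃ a : unitSphere, (ν : Measure unitSphere) {a} ≠ 0 := by
      by_contra! hno
      have h2 : (ν : Measure unitSphere) {x : unitSphere | (F x).re = (J f).re} = 0 := by
        rw [← Set.biUnion_of_singleton {x : unitSphere | (F x).re = (J f).re},
          measure_biUnion_null_iff hfin.countable]
        exact fun a _ => hno a
      obtain ⟨x, hx1, hx2⟩ := (hae.and (measure_eq_zero_iff_ae_notMem.1 h2)).exists
      exact hx2 hx1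
    obtain ⟨a, ha⟩ := hatom
    exact ⟨a, norm_coe_unitSphere a, hν.eq_extremalFun _ (circleMoment_eq_pow_of_atom hrec ha)⟩
  · have hconst : ∀ k ∈ classG, (J k).re = (J f).re := by
      intro k hk
      obtain ⟨ξ, hξ⟩ := classG_subset_momentClass hk
      rw [hre k ξ hξ]
      simp [hall]
    exact absurd ((hconst g hg).trans (hconst h hh).symm) hgh

theorem theorem3p1 :
    supportPoints classG = Set.extremePoints ℝ (closedConvexHull ℝ classG) ∧
    Set.extremePoints ℝ (closedConvexHull ℝ classG) =
      {f : AnalyticDisk | ∃ (x : ℂ) (hx : ‖x‖ = 1), f = extremalFun x hx} := by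
  refine ⟨?_, extremePoints_closedConvexHull_classG⟩
  rw [extremePoints_closedConvexHull_classG]
  ext f
  constructor
  · exact exists_eq_extremalFun_of_mem_supportPoints
  · rintro ⟨x, hx, rfl⟩
    exact extremalFun_mem_supportPoints hx
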